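/- Let $\mathbb D$ be the open unit disk, $\mathbb T$ the unit circle, $m$ normalized Lebesgue measure on $\mathbb T$, and let $H^2$ be the Hardy space of analytic $f$ on $\mathbb D$ with $\|f\|_{H^2}^2=\sup_{0<r<1}\int_{\mathbb T}|f(r\xi)|^2\,dm(\xi)<\infty$. Let $b$ be a rational function, analytic on $\mathbb D$ with $|b|\le 1$ there, that is not a finite Blaschke product (unimodular constants count as finite Blaschke products), and let $\mathscr H(b)$ be the de Branges--Rovnyak space, that is, the reproducing kernel Hilbert space on $\mathbb D$ with kernel $k_\lambda(z)=\dfrac{1-b(z)\overline{b(\lambda)}}{1-\overline\lambda z}$. Let $a$ be the Pythagorean mate of $b$: the rational function without poles in $\overline{\mathbb D}$ and without zeros in $\mathbb D$ such that $a(0)>0$ and $|a|^2+|b|^2=1$ on $\mathbb T$. Let $\xi_1,\dots,\xi_n$ be the distinct zeros of $a$ on $\mathbb T$, with multiplicities $m_1,\dots,m_n$, and put $a_1(z)=\prod_{j=1}^n(z-\xi_j)^{m_j}$ and $N=m_1+\dots+m_n$ (so $a_1=1$ and $N=0$ if there are none). Let $\mathscr P_{N-1}$ be the space of polynomials of degree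 at most $N-1$ ($\mathscr P_{-1}=\{0\}$). It is known that $\mathscr H(b)=a_1H^2\dotplus\mathscr P_{N-1}$ as sets of functions, and that $$\|a_1\tilde f+p\|_b^2:=\|\tilde f\|_{H^2}^2+\|p\|_{H^2}^2\qquad(\tilde f\in H^2,\ p\in\mathscr P_{N-1})$$ defines an equivalent norm on $\mathscr H(b)$; below, $\mathscr H(b)$ carries this norm. Let $\mathfrak M(\mathscr H(b))=\{\varphi\in\mathscr H(b):\varphi\mathscr H(b)\subset\mathscr H(b)\}$, and let $\|\varphi\|_{\mathfrak M(\mathscr H(b))}$ be the operator norm of $f\mapsto\varphi f$ on $(\mathscr H(b),\|\cdot\|_b)$. For a polynomial $p$ let $\|p\|$ be the maximum of the moduli of its coefficients. Then there is a constant $C_1>0$ with $$\max\{\|p\|,\ \|p\|_{\mathfrak M(\mathscr H(b))}\}\le C_1\|p\|_{H^2}\quad\text{for all }p\in\mathscr P_{N-1}.\tag{$*$}$$ For every sequence $\Phi=(\varphi_j)_{j\ge1}$ in $\mathfrak M(\mathscr H(b))$, the column multiplier $\mathbf M_\Phi f=(\varphi_jf)_{j\ge1}$ is a bounded operator from $\mathscr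 H(b)$ to the Hilbert direct sum $\bigoplus_{j=1}^\infty\mathscr H(b)$ if and only if $$C_2:=\Big(\sum_{j=1}^\infty\|\varphi_j\|_b^2\Big)^{1/2}<\infty\quad\text{and}\quad C_3:=\sup_{z\in\mathbb D}\Big(\sum_{j=1}^\infty|\varphi_j(z)|^2\Big)^{1/2}<\infty .$$ Moreover, for every $C_1>0$ satisfying $(*)$, $$\max(C_2,C_3)\le\|\mathbf M_\Phi\|\le\sqrt2\,\max(C_3,\,C_1C_2),$$ where the value $\infty$ is allowed for $C_2$, $C_3$ and $\|\mathbf M_\Phi\|$. -/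

import Mathlib

open MeasureTheory
open scoped ENNReal NNReal ComplexConjugate Complex.UnitDisc

noncomputable section

namespace DBR

/-! ### The Hardy space of the unit disk -/

/-- The point `r * exp (i θ)` of the open unit disk, for `0 < r < 1`. -/
def circlePoint (r : Set.Ioo (0 : ℝ) 1) (θ : ℝ) : 𝔻 :=
  Complex.UnitDisc.mk (circleMap 0 r θ) (by
    rw [norm_circleMap_zero, abs_of_pos r.2.1]
    exact r.2.2)

/-- `f` is analytic (equivalently, holomorphic) on the open unit disk. -/
def IsHolomorphic (f : 𝔻 → ℂ) : Prop :=
  ∃ F : ℂ → ℂ, DifferentiableOn ℂ F (Metric.ball 0 1) ∧ ∀ z : 𝔻, f z = F z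

/-- The Hardy norm `(sup_{0 < r < 1} ∫_𝕋 |f(r ξ)|² dm(ξ))^{1/2}`, with `m` the normalized Lebesgue
measure of the unit circle; the value `∞` is allowed. -/
def hardyNorm (f : 𝔻 → ℂ) : ℝ≥0∞ :=
  (⨆ r : Set.Ioo (0 : ℝ) 1,
    (ENNReal.ofReal (2 * Real.pi))⁻¹ *
      ∫⁻ θ in Set.Ioc 0 (2 * Real.pi), ‖f (circlePoint r θ)‖ₑ ^ 2) ^ (1 / 2 : ℝ)

/-- The Hardy space `H²`. -/
def hardySpace : Set (𝔻 → ℂ) :=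
  {f | IsHolomorphic f ∧ hardyNorm f < ∞}

/-- A polynomial as a function on the disk. -/
def polyFun (p : Polynomial ℂ) : 𝔻 → ℂ := fun z => p.eval (z : ℂ)

/-! ### Rational functions in the closed unit ball of `H^∞` -/

/-- The value of a rational function, in lowest terms, at a point. -/
def ratVal (b : RatFunc ℂ) (z : ℂ) : ℂ := b.eval (RingHom.id ℂ) z

/-- `b` has no pole in the open unit disk, and `|b| ≤ 1` there. -/
def InUnitBall (b : RatFunc ℂ) : Prop :=
  ∀ z : 𝔻, b.denom.eval (z : ℂ) ≠ 0 ∧ ‖ratVal b z‖ ≤ 1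

/-- `b` is a finite Blaschke product; the empty product, a unimodular constant, is included. -/
def IsFiniteBlaschke (b : RatFunc ℂ) : Prop :=
  ∃ (n : ℕ) (α : Fin n → 𝔻) (c : ℂ), ‖c‖ = 1 ∧
    ∀ z : 𝔻, ratVal b z = c * ∏ i, ((z : ℂ) - α i) / (1 - conj (α i : ℂ) * z)

/-- `a` is the Pythagorean mate of `b`: a rational function without poles in the closed unit disk
and without zeros in the open unit disk, with `a(0) > 0` and `|a|² + |b|² = 1` on the unit circle.
-/
structure IsPythagoreanMate (b a : RatFunc ℂ) : Prop where
  no_pole : ∀ z : ℂ, ‖z‖ ≤ 1 → a.denom.eval z ≠ 0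
  no_zero : ∀ z : 𝔻, ratVal a z ≠ 0
  zero_real : (ratVal a 0).im = 0
  zero_pos : 0 < (ratVal a 0).re
  mate : ∀ ξ : ℂ, ‖ξ‖ = 1 → ‖ratVal a ξ‖ ^ 2 + ‖ratVal b ξ‖ ^ 2 = 1

open Classical in
/-- The polynomial `a₁(z) = ∏ (z - ξ_j)^{m_j}`, where the `ξ_j` are the distinct zeros of `a` on the
unit circle and the `m_j` their multiplicities. -/
def boundaryPoly (a : RatFunc ℂ) : Polynomial ℂ :=
  ((a.num.roots.filter fun ξ => ‖ξ‖ = 1).map fun ξ => Polynomial.X - Polynomial.C ξ).prod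

/-- The number `N = ∑ m_j` of zeros of `a` on the unit circle, counted with multiplicity. -/
def boundaryDeg (a : RatFunc ℂ) : ℕ := (boundaryPoly a).natDegree

/-! ### The de Branges--Rovnyak space and its equivalent norm -/

/-- The kernel `k_w(z) = (1 - b(z) conj(b(w))) / (1 - conj(w) z)`. -/
def dbrKernel (b : RatFunc ℂ) (z w : 𝔻) : ℂ :=
  (1 - ratVal b z * conj (ratVal b w)) / (1 - conj (w : ℂ) * z)

/-- The de Branges--Rovnyak space `H(b)`, as a set of functions on the disk: the functions that
belong to the reproducing kernel Hilbert space with kernel `dbrKernel b`. (That space is unique as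
a space of functions.) -/
def dbrSpace (b : RatFunc ℂ) : Set (𝔻 → ℂ) :=
  {f | ∃ (H : Type) (_ : NormedAddCommGroup H) (_ : InnerProductSpace ℂ H) (_ : CompleteSpace H)
      (_ : RKHS ℂ H 𝔻 ℂ),
      (∀ z w : 𝔻, RKHS.kernel H z w 1 = dbrKernel b z w) ∧ ∃ g : H, ⇑g = f}

/-- `f = a₁ g + p` with `g ∈ H²` and `p` a polynomial of degree at most `N - 1`
(with `p = 0` if `N = 0`). -/
def IsDecomposition (a : RatFunc ℂ) (f g : 𝔻 → ℂ) (p : Polynomial ℂ) : Prop :=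
  g ∈ hardySpace ∧ p ∈ Polynomial.degreeLT ℂ (boundaryDeg a) ∧
    f = polyFun (boundaryPoly a) * g + polyFun p

/-- The norm `‖a₁ g + p‖_b = (‖g‖² + ‖p‖²)^{1/2}`, the norms on the right being those of `H²`.
A function has at most one decomposition, so that the infimum only picks its value; it is `∞` for a
function that has none. -/
def dbrNorm (a : RatFunc ℂ) (f : 𝔻 → ℂ) : ℝ≥0∞ :=
  (⨅ (g : 𝔻 → ℂ) (p : Polynomial ℂ) (_ : IsDecomposition a f g p),
    (hardyNorm g ^ 2 + hardyNorm (polyFun p) ^ 2)) ^ (1 / 2 : ℝ)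

/-! ### Multipliers and column multipliers -/

/-- The multiplier algebra of `H(b)`. -/
def multipliers (b : RatFunc ℂ) : Set (𝔻 → ℂ) :=
  {φ | φ ∈ dbrSpace b ∧ ∀ f ∈ dbrSpace b, φ * f ∈ dbrSpace b}

/-- The norm of the multiplication operator `f ↦ φ f` on `H(b)` with the norm `‖·‖_b`
(`∞` if it is unbounded). -/
def multiplierNorm (b a : RatFunc ℂ) (φ : 𝔻 → ℂ) : ℝ≥0∞ :=
  sInf {C : ℝ≥0∞ | ∀ f ∈ dbrSpace b, dbrNorm a (φ * f) ≤ C * dbrNorm a f}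

/-- The norm of a sequence of functions in the Hilbert direct sum of copies of `H(b)`
(`∞` if the sequence is not square summable). -/
def directSumNorm (a : RatFunc ℂ) (F : ℕ → 𝔻 → ℂ) : ℝ≥0∞ :=
  (∑' j, dbrNorm a (F j) ^ 2) ^ (1 / 2 : ℝ)

/-- The column multiplier `M_Φ f = (φ_j f)_j`. -/
def columnMul (Φ : ℕ → 𝔻 → ℂ) (f : 𝔻 → ℂ) : ℕ → 𝔻 → ℂ := fun j => Φ j * f

/-- `M_Φ` is a bounded operator from `H(b)` to the Hilbert direct sum of copies of `H(b)`. -/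
def IsBoundedColumn (b a : RatFunc ℂ) (Φ : ℕ → 𝔻 → ℂ) : Prop :=
  ∃ C : ℝ≥0, ∀ f ∈ dbrSpace b,
    (∀ j, columnMul Φ f j ∈ dbrSpace b) ∧
      directSumNorm a (columnMul Φ f) ≤ C * dbrNorm a f

/-- The operator norm of `M_Φ` (`∞` if `M_Φ` is unbounded). -/
def columnNorm (b a : RatFunc ℂ) (Φ : ℕ → 𝔻 → ℂ) : ℝ≥0∞ :=
  sInf {C : ℝ≥0∞ | ∀ f ∈ dbrSpace b, directSumNorm a (columnMul Φ f) ≤ C * dbrNorm a f}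

/-- `C₁ > 0` dominates, on the polynomials `p` of degree at most `N - 1`, the largest modulus of a
coefficient and the multiplier norm of `p` by `C₁` times the `H²` norm of `p`. -/
def IsPolyConstant (b a : RatFunc ℂ) (C₁ : ℝ≥0) : Prop :=
  0 < C₁ ∧ ∀ p ∈ Polynomial.degreeLT ℂ (boundaryDeg a),
    max (ENNReal.ofReal p.supNorm) (multiplierNorm b a (polyFun p)) ≤ C₁ * hardyNorm (polyFun p)

/-- `C₂ = (∑ ‖φ_j‖_b²)^{1/2}`. -/
def constTwo (a : RatFunc ℂ) (Φ : ℕ → 𝔻 → ℂ) : ℝ≥0∞ :=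
  (∑' j, dbrNorm a (Φ j) ^ 2) ^ (1 / 2 : ℝ)

/-- `C₃ = sup_z (∑ |φ_j(z)|²)^{1/2}`. -/
def constThree (Φ : ℕ → 𝔻 → ℂ) : ℝ≥0∞ :=
  ⨆ z : 𝔻, (∑' j, ‖Φ j z‖ₑ ^ 2) ^ (1 / 2 : ℝ)

end DBR

end

noncomputable section

namespace DBR

open Complex Metric Filter Topology

/-! Upper bound. If `f = a₁ g + p`, then `φ_j f = a₁ (φ_j g) + p φ_j`. The first summand costs the
Hardy norm of `φ_j g`, and integrating the pointwise bound on `∑ |φ_j|²` over circles gives at most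
`C₃² ‖g‖²` after summation. In the second, `p` acts as a multiplier on `φ_j`, and the sum is at most
`C₁² ‖p‖² C₂²`. The inequality `‖x + y‖² ≤ 2‖x‖² + 2‖y‖²` joins the two and produces the factor `√2`
(`directSumNorm_columnMul_le`). A finite `C₁` exists because multiplication by `z` is bounded for
`‖·‖_b`: the overflow of `z q` into degree `N` is absorbed by a multiple of the monic polynomial
`a₁`.

Lower bound. Testing on `1`, of norm at most one, gives `C₂`. Testing on the reproducing kernel
`k_z` of the norm `‖·‖_b` gives `C₃`: with `κ = k_z(z)`, one has `|h(z)|² ≤ κ ‖h‖_b²` and `‖k_z‖_b²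
≤ κ`, so `κ` cancels.

These test functions must be shown to lie in `H(b)`, and the decomposition of `H(b)` is not used for
this. For a combination `h = ∑ c_w s_w` of Szegő kernels, the quadratic form of the kernel of `H(b)`
dominates `∫ |a h|²` on the circle (`circleAverage_le_kernel_sum`). Hence `f` belongs to `H(b)` as
soon as `∑ c_w s_w ↦ ∑ c_w conj(f(w))` is bounded for the norm of `a h`. For polynomials this
functional reads Taylor coefficients of `h` at the origin, and for Szegő kernels values of `h`; both
are controlled because `a` has no zero in the disk. -/

theorem exists_eq_coe_of_bound {X H : Type*} [NormedAddCommGroup H] [InnerProductSpace ℂ H]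
    [CompleteSpace H] [RKHS ℂ H X ℂ] (f : X → ℂ) (C : ℝ)
    (hC : ∀ c : X →₀ ℂ, ‖c.sum fun w z => z * conj (f w)‖ ≤
      C * ‖c.sum fun w z => z • RKHS.kerFun H w (1 : ℂ)‖) :
    ∃ g : H, ⇑g = f := by
  let T : (X →₀ ℂ) →ₗ[ℂ] H := Finsupp.linearCombination ℂ fun w => RKHS.kerFun H w (1 : ℂ)
  let L : (X →₀ ℂ) →ₗ[ℂ] ℂ := Finsupp.linearCombination ℂ fun w => conj (f w)
  have hTL : ∀ c, ‖L c‖ ≤ C * ‖T c‖ := fun c => by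
    simpa [L, T, Finsupp.linearCombination_apply] using hC c
  have hker : LinearMap.ker T ≤ LinearMap.ker L := fun c hc => by
    have h := hTL c
    rw [LinearMap.mem_ker.1 hc, norm_zero, mul_zero, norm_le_zero_iff] at h
    exact h
  -- The bound makes `L` vanish on the kernel of `T`, so `L` descends to the span of the kernel
  -- functions.
  let L' : LinearMap.range T →ₗ[ℂ] ℂ :=
    ((LinearMap.ker T).liftQ L hker) ∘ₗ (T.quotKerEquivRange.symm : _ →ₗ[ℂ] _)
  have hL' : ∀ c, L' ⟨T c, LinearMap.mem_range_self T c⟩ = L c := fun c => by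
    have h : T.quotKerEquivRange.symm ⟨T c, LinearMap.mem_range_self T c⟩ =
        Submodule.Quotient.mk c := by
      rw [LinearEquiv.symm_apply_eq]
      rfl
    simp [L', h]
  let Lc : LinearMap.range T →L[ℂ] ℂ := L'.mkContinuous C (by
    rintro ⟨_, c, rfl⟩
    rw [hL']
    exact hTL c)
  -- The span need not be closed: the Hahn–Banach extension comes before the Riesz representation.
  obtain ⟨ψ, hψ, -⟩ := exists_extension_norm_eq (LinearMap.range T) Lc
  refine ⟨(InnerProductSpace.toDual ℂ H).symm ψ, funext fun x => ?_⟩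
  set g := (InnerProductSpace.toDual ℂ H).symm ψ with hg
  have hx : T (Finsupp.single x 1) = RKHS.kerFun H x (1 : ℂ) := by simp [T]
  have h1 : ψ (RKHS.kerFun H x (1 : ℂ)) = conj (f x) := by
    have := hψ ⟨T (Finsupp.single x 1), LinearMap.mem_range_self T _⟩
    rw [← hx, this]
    change L' _ = _
    rw [hL']
    simp [L]
  have h2 : ψ (RKHS.kerFun H x (1 : ℂ)) = conj (g x) := by
    rw [← InnerProductSpace.toDual_symm_apply (𝕜 := ℂ) (y := ψ), ← hg, RKHS.inner_kerFun]
    simp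
  exact (starRingEnd ℂ).injective (h2.symm.trans h1)

/-! ### Szegő kernels and averages over the unit circle -/

/-- The Szegő kernel `1 / (1 - conj(w) z)`. -/
def szego (w z : ℂ) : ℂ := (1 - conj w * z)⁻¹

theorem one_sub_conj_mul_ne_zero {w z : ℂ} (hw : ‖w‖ < 1) (hz : ‖z‖ ≤ 1) :
    1 - conj w * z ≠ 0 := by
  intro h
  have h1 : ‖conj w * z‖ = 1 := by rw [← sub_eq_zero.1 h, norm_one]
  rw [norm_mul, RCLike.norm_conj] at h1
  nlinarith [norm_nonneg w, norm_nonneg z]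

theorem szego_conj (w z : ℂ) : conj (szego w z) = szego z w := by
  simp [szego, mul_comm]

theorem diffContOnCl_ball_of_differentiableAt {F : ℂ → ℂ}
    (h : ∀ z, ‖z‖ ≤ 1 → DifferentiableAt ℂ F z) : DiffContOnCl ℂ F (ball 0 1) := by
  refine DifferentiableOn.diffContOnCl fun z hz => (h z ?_).differentiableWithinAt
  rw [closure_ball _ one_ne_zero] at hz
  simpa using hz

theorem differentiableAt_szego {w z : ℂ} (hw : ‖w‖ < 1) (hz : ‖z‖ ≤ 1) :
    DifferentiableAt ℂ (szego w) z := by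
  unfold szego
  exact DifferentiableAt.inv (by fun_prop) (one_sub_conj_mul_ne_zero hw hz)

theorem circleIntegrable_of_continuousOn {E : Type*} [NormedAddCommGroup E] {F : ℂ → E}
    (h : ContinuousOn F (sphere 0 1)) : CircleIntegrable F 0 1 :=
  h.circleIntegrable zero_le_one

/-- Cauchy's formula: on the circle `conj ζ = ζ⁻¹`, so the conjugate Szegő kernel is `ζ / (ζ - w)`.
-/
theorem circleAverage_mul_conj_szego {F : ℂ → ℂ} (hF : DiffContOnCl ℂ F (ball 0 1)) {w : ℂ}
    (hw : ‖w‖ < 1) : Real.circleAverage (fun ζ => F ζ * conj (szego w ζ)) 0 1 = F w := by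
  have h := DiffContOnCl.circleAverage_smul_div (f := F) (c := 0) (R := 1) (w := w)
    (by simpa using hF) (by simpa using hw)
  rw [← h]
  refine Real.circleAverage_congr_sphere fun z hz => ?_
  have hz1 : ‖z‖ = 1 := by simpa using hz
  have hz0 : z ≠ 0 := fun h => by simp [h] at hz1
  have hzz : conj z = z⁻¹ := by rw [Complex.inv_eq_conj hz1]
  have : z - w ≠ 0 := fun h => by rw [← sub_eq_zero.1 h] at hw; linarith
  rw [szego_conj w z, szego, hzz, sub_zero, smul_eq_mul, mul_comm]
  congr 1
  field_simp

/-- Point evaluation at `w` is bounded for the norm of `L²(𝕋)`. -/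
theorem sq_norm_le_circleAverage {F : ℂ → ℂ} (hF : DiffContOnCl ℂ F (ball 0 1)) {w : ℂ}
    (hw : ‖w‖ < 1) :
    ‖F w‖ ^ 2 ≤ (1 - ‖w‖)⁻¹ * Real.circleAverage (fun ζ => ‖F ζ‖ ^ 2) 0 1 := by
  -- Applying the reproducing formula to `F²` puts `|F|²` directly under the integral.
  have hF2 : DiffContOnCl ℂ (fun z => F z * F z) (ball 0 1) := hF.smul hF
  have hc : ContinuousOn F (sphere 0 1) :=
    hF.continuousOn.mono (by rw [closure_ball _ one_ne_zero]; exact sphere_subset_closedBall)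
  rw [sq, ← norm_mul, ← circleAverage_mul_conj_szego hF2 hw, ← smul_eq_mul,
    ← Real.circleAverage_fun_smul]
  have hsz : ∀ ζ ∈ sphere (0 : ℂ) 1, ‖szego w ζ‖ ≤ (1 - ‖w‖)⁻¹ := fun ζ hζ => by
    have hζ1 : ‖ζ‖ = 1 := by simpa using hζ
    rw [szego, norm_inv]
    refine inv_anti₀ (by linarith) ?_
    have := norm_sub_norm_le (1 : ℂ) (conj w * ζ)
    rwa [norm_one, norm_mul, RCLike.norm_conj, hζ1, mul_one] at this
  have hs : ContinuousOn (szego w) (sphere 0 1) := fun z hz =>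
    (differentiableAt_szego hw (by simp_all)).continuousAt.continuousWithinAt
  rw [Real.circleAverage_def, norm_smul, Real.circleAverage_def, smul_eq_mul]
  rw [Real.norm_of_nonneg (by positivity)]
  refine mul_le_mul_of_nonneg_left ?_ (by positivity)
  refine (intervalIntegral.norm_integral_le_integral_norm (by positivity)).trans ?_
  have hm : ∀ θ, circleMap 0 1 θ ∈ sphere (0 : ℂ) 1 := circleMap_mem_sphere 0 zero_le_one
  have hi1 : CircleIntegrable (fun ζ => ‖F ζ * F ζ * conj (szego w ζ)‖) 0 1 :=
    circleIntegrable_of_continuousOn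
      ((hc.mul hc).mul (Complex.continuous_conj.comp_continuousOn hs)).norm
  have hi2 : CircleIntegrable (fun ζ => (1 - ‖w‖)⁻¹ • ‖F ζ‖ ^ 2) 0 1 :=
    circleIntegrable_of_continuousOn (by fun_prop)
  refine intervalIntegral.integral_mono_on (by positivity) hi1 hi2 fun θ _ => ?_
  simp only [norm_mul, RCLike.norm_conj, smul_eq_mul]
  nlinarith [hsz _ (hm θ), mul_self_nonneg ‖F (circleMap 0 1 θ)‖]

/-! ### Positivity of the kernel of `H(b)` -/

section Kernel

variable {b a : RatFunc ℂ}

theorem ratVal_eq_div (b : RatFunc ℂ) (z : ℂ) : ratVal b z = b.num.eval z / b.denom.eval z := by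
  simp [ratVal, RatFunc.eval]

theorem differentiableAt_ratVal {z : ℂ} (h : b.denom.eval z ≠ 0) :
    DifferentiableAt ℂ (ratVal b) z := by
  have : ratVal b = fun z => b.num.eval z / b.denom.eval z := funext (ratVal_eq_div b)
  rw [this]
  exact b.num.differentiableAt.div b.denom.differentiableAt h

/-- By continuity `|num| ≤ |denom|` on the closed disk, so a pole on the circle would be a common
zero, against coprimality. -/
theorem InUnitBall.denom_ne_zero (hb : InUnitBall b) {z : ℂ} (hz : ‖z‖ ≤ 1) :
    b.denom.eval z ≠ 0 := by
  have hle : ∀ z ∈ closure (ball (0 : ℂ) 1), ‖b.num.eval z‖ ≤ ‖b.denom.eval z‖ := by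
    refine le_on_closure (fun z hz => ?_) b.num.continuous.norm.continuousOn
      b.denom.continuous.norm.continuousOn
    obtain ⟨h0, h1⟩ := hb (UnitDisc.mk z (by simpa using hz))
    rw [ratVal_eq_div, UnitDisc.coe_mk, norm_div] at h1
    rw [UnitDisc.coe_mk] at h0
    rwa [div_le_one (norm_pos_iff.2 h0)] at h1
  intro h0
  have h1 := hle z (by rw [closure_ball _ one_ne_zero]; simpa using hz)
  rw [h0, norm_zero, norm_le_zero_iff] at h1
  obtain ⟨u, v, huv⟩ := b.isCoprime_num_denom
  have := congrArg (Polynomial.eval z) huv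
  simp [h0, h1] at this

/-- A finite combination of Szegő kernels. -/
def szegoSum (s : Finset 𝔻) (c : 𝔻 → ℂ) (z : ℂ) : ℂ := ∑ w ∈ s, c w * szego w z

theorem differentiableAt_szegoSum (s : Finset 𝔻) (c : 𝔻 → ℂ) {z : ℂ} (hz : ‖z‖ ≤ 1) :
    DifferentiableAt ℂ (szegoSum s c) z := by
  unfold szegoSum
  exact DifferentiableAt.fun_sum fun w _ =>
    (differentiableAt_szego w.norm_lt_one hz).const_mul _

theorem continuousOn_sphere_of_differentiableAt {F : ℂ → ℂ}
    (h : ∀ z, ‖z‖ ≤ 1 → DifferentiableAt ℂ F z) : ContinuousOn F (sphere 0 1) := fun z hz =>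
  (h z (by simp_all)).continuousAt.continuousWithinAt

theorem circleAverage_mul_conj_szegoSum {u : ℂ → ℂ} (hu : ∀ z, ‖z‖ ≤ 1 → DifferentiableAt ℂ u z)
    (s : Finset 𝔻) (d : 𝔻 → ℂ) :
    Real.circleAverage (fun ζ => (u ζ * conj (szegoSum s d ζ)).re) 0 1 =
      (∑ x ∈ s, conj (d x) * u x).re := by
  have hc := continuousOn_sphere_of_differentiableAt hu
  have hs : ∀ w : 𝔻, ContinuousOn (szego w) (sphere 0 1) := fun w =>
    continuousOn_sphere_of_differentiableAt fun z hz => differentiableAt_szego w.norm_lt_one hz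
  have hi : ∀ x ∈ s, CircleIntegrable (fun ζ => conj (d x) • (u ζ * conj (szego x ζ))) 0 1 :=
    fun x _ => circleIntegrable_of_continuousOn
      ((hc.mul (Complex.continuous_conj.comp_continuousOn (hs x))).const_smul (conj (d x)))
  have h1 : (fun ζ => (u ζ * conj (szegoSum s d ζ))) =
      fun ζ => ∑ x ∈ s, conj (d x) • (u ζ * conj (szego x ζ)) := by
    funext ζ
    simp only [szegoSum, map_sum, Finset.mul_sum, map_mul, smul_eq_mul]
    exact Finset.sum_congr rfl fun x _ => by ring
  have h2 : CircleIntegrable (fun ζ => (u ζ * conj (szegoSum s d ζ))) 0 1 := by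
    rw [h1]
    exact CircleIntegrable.fun_sum s hi
  have h3 := Complex.reCLM.circleAverage_comp_comm h2
  have h4 : Complex.reCLM ∘ (fun ζ => (u ζ * conj (szegoSum s d ζ))) =
    fun ζ => (u ζ * conj (szegoSum s d ζ)).re := rfl
  rw [h4] at h3
  rw [h3, h1, Real.circleAverage_fun_sum hi]
  simp_rw [Real.circleAverage_fun_smul, circleAverage_mul_conj_szego
    (diffContOnCl_ball_of_differentiableAt hu) (UnitDisc.norm_lt_one _)]
  simp

/-- The form equals `‖h‖² - ‖g‖²` in `L²(𝕋)`, where `g` is the image of `h` under the Toeplitz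
operator with symbol `conj b`. Since `‖g‖ ≤ ‖b h‖`, it is at least `‖h‖² - ‖b h‖² = ‖a h‖²`. -/
theorem circleAverage_le_kernel_sum (hb : InUnitBall b) (ha : IsPythagoreanMate b a)
    (s : Finset 𝔻) (c : 𝔻 → ℂ) :
    Real.circleAverage (fun ζ => ‖ratVal a ζ * szegoSum s c ζ‖ ^ 2) 0 1 ≤
      (∑ x ∈ s, ∑ w ∈ s, conj (c x) * c w * dbrKernel b x w).re := by
  set h := szegoSum s c with hh
  set g := szegoSum s (fun w => c w * conj (ratVal b w)) with hg
  set B := ratVal b with hBdef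
  set A := ratVal a
  have hhd : ∀ z, ‖z‖ ≤ 1 → DifferentiableAt ℂ h z := fun z => differentiableAt_szegoSum s _
  have hgd : ∀ z, ‖z‖ ≤ 1 → DifferentiableAt ℂ g z := fun z => differentiableAt_szegoSum s _
  have hBd : ∀ z, ‖z‖ ≤ 1 → DifferentiableAt ℂ B z := fun z hz =>
    differentiableAt_ratVal (hb.denom_ne_zero hz)
  have hhc := continuousOn_sphere_of_differentiableAt hhd
  have hgc := continuousOn_sphere_of_differentiableAt hgd
  have hBc := continuousOn_sphere_of_differentiableAt hBd
  have key1 := circleAverage_mul_conj_szegoSum hhd s c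
  have key2 := circleAverage_mul_conj_szegoSum hgd s (fun w => c w * conj (B w))
  have key3 := circleAverage_mul_conj_szegoSum (u := fun z => B z * g z)
    (fun z hz => (hBd z hz).mul (hgd z hz)) s c
  rw [← hh] at key1 key3
  rw [← hg] at key2
  have hre : ∀ z : ℂ, (z * conj z).re = ‖z‖ ^ 2 := fun z => by
    rw [Complex.mul_conj, Complex.ofReal_re, Complex.normSq_eq_norm_sq]
  simp only [hre] at key1 key2
  have hsum : (∑ x ∈ s, ∑ w ∈ s, conj (c x) * c w * dbrKernel b x w) =
      ∑ x ∈ s, conj (c x) * h x - ∑ x ∈ s, conj (c x) * (B x * g x) := by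
    rw [← Finset.sum_sub_distrib]
    refine Finset.sum_congr rfl fun x _ => ?_
    rw [← mul_sub, hh, hg]
    simp only [szegoSum, Finset.mul_sum, ← Finset.sum_sub_distrib]
    refine Finset.sum_congr rfl fun w _ => ?_
    rw [dbrKernel, szego, ← hBdef, div_eq_mul_inv]
    ring
  have hkey2 : Real.circleAverage (fun ζ => ‖g ζ‖ ^ 2) 0 1 =
      (∑ x ∈ s, conj (c x) * (B x * g x)).re := by
    rw [key2]
    congr 1
    refine Finset.sum_congr rfl fun x _ => ?_
    simp
    ring
  have ci : ∀ {F : ℂ → ℝ}, ContinuousOn F (sphere 0 1) → CircleIntegrable F 0 1 :=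
    circleIntegrable_of_continuousOn
  have hgint : CircleIntegrable (fun ζ => ‖g ζ‖ ^ 2) 0 1 := ci (hgc.norm.pow 2)
  have hhint : CircleIntegrable (fun ζ => ‖h ζ‖ ^ 2) 0 1 := ci (hhc.norm.pow 2)
  have hBhint : CircleIntegrable (fun ζ => ‖B ζ * h ζ‖ ^ 2) 0 1 := ci ((hBc.mul hhc).norm.pow 2)
  have hcross : Real.circleAverage (fun ζ => ‖g ζ‖ ^ 2) 0 1 ≤
      Real.circleAverage (fun ζ => ‖B ζ * h ζ‖ ^ 2) 0 1 := by
    -- Here `‖g‖² = Re ∫ b g conj(h)`, and `2xy ≤ x² + y²` under the integral replaces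
    -- Cauchy–Schwarz.
    have h1 : 2 * Real.circleAverage (fun ζ => ‖g ζ‖ ^ 2) 0 1 ≤
        Real.circleAverage (fun ζ => ‖g ζ‖ ^ 2) 0 1 +
          Real.circleAverage (fun ζ => ‖B ζ * h ζ‖ ^ 2) 0 1 := by
      nth_rewrite 1 [hkey2]
      rw [← key3, ← Real.circleAverage_fun_add hgint hBhint, ← smul_eq_mul,
        ← Real.circleAverage_fun_smul]
      refine Real.circleAverage_mono (ci ?_) (hgint.add hBhint) fun ζ hζ => ?_
      · exact ((Complex.continuous_re.comp_continuousOn ((hBc.mul hgc).mul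
          (Complex.continuous_conj.comp_continuousOn hhc))).const_smul (2 : ℝ))
      · have h2 : (B ζ * g ζ * conj (h ζ)).re ≤ ‖g ζ‖ * ‖B ζ * h ζ‖ := by
          refine (Complex.re_le_norm _).trans (le_of_eq ?_)
          simp only [norm_mul, RCLike.norm_conj]
          ring
        simp only [smul_eq_mul]
        nlinarith [sq_nonneg (‖g ζ‖ - ‖B ζ * h ζ‖)]
    linarith
  rw [hsum, Complex.sub_re, ← hkey2, ← key1]
  have hAh : Real.circleAverage (fun ζ => ‖A ζ * h ζ‖ ^ 2) 0 1 =
      Real.circleAverage (fun ζ => ‖h ζ‖ ^ 2) 0 1 -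
        Real.circleAverage (fun ζ => ‖B ζ * h ζ‖ ^ 2) 0 1 := by
    rw [← Real.circleAverage_fun_sub hhint hBhint]
    refine Real.circleAverage_congr_sphere fun ζ hζ => ?_
    have := ha.mate ζ (by simpa using hζ)
    simp only [norm_mul, mul_pow]
    linear_combination ‖h ζ‖ ^ 2 * this
  linarith

/-- The kernel as an operator-valued matrix. -/
def kernelMatrix (b : RatFunc ℂ) : Matrix 𝔻 𝔻 (ℂ →L[ℂ] ℂ) :=
  .of fun x y => dbrKernel b x y • (1 : ℂ →L[ℂ] ℂ)

theorem dbrKernel_conj (x y : 𝔻) : conj (dbrKernel b x y) = dbrKernel b y x := by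
  simp [dbrKernel, mul_comm]

theorem posSemidef_kernelMatrix (hb : InUnitBall b) (ha : IsPythagoreanMate b a) :
    (kernelMatrix b).PosSemidef := by
  have hiff := (RKHS.posSemidef_tfae (K := kernelMatrix b)).out 0 2
  refine hiff.2 ⟨?_, fun vv => ?_⟩
  · ext x y
    rw [Matrix.conjTranspose_apply]
    simp [kernelMatrix, dbrKernel_conj]
  · have h := circleAverage_le_kernel_sum hb ha vv.support vv
    have h0 : 0 ≤ Real.circleAverage (fun ζ => ‖ratVal a ζ * szegoSum vv.support vv ζ‖ ^ 2) 0 1 :=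
      Real.circleAverage_nonneg_of_nonneg fun _ _ => by positivity
    refine (h0.trans h).trans_eq ?_
    simp only [Finsupp.sum]
    change _ = Complex.re _
    congr 1
    refine Finset.sum_congr rfl fun x _ => Finset.sum_congr rfl fun w _ => ?_
    simp [kernelMatrix, dbrKernel_conj]
    ring

end Kernel

/-! ### Polynomials and polynomial multiples of Szegő kernels belong to `H(b)` -/

section Membership

variable {b a : RatFunc ℂ}

theorem mem_dbrSpace_of_bound (hb : InUnitBall b) (ha : IsPythagoreanMate b a) {f : 𝔻 → ℂ} {C : ℝ}
    (hC : 0 ≤ C) (h : ∀ (s : Finset 𝔻) (c : 𝔻 → ℂ), ‖∑ w ∈ s, c w * conj (f w)‖ ^ 2 ≤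
      C * Real.circleAverage (fun ζ => ‖ratVal a ζ * szegoSum s c ζ‖ ^ 2) 0 1) :
    f ∈ dbrSpace b := by
  have : Fact (kernelMatrix b).PosSemidef := ⟨posSemidef_kernelMatrix hb ha⟩
  have hk : ∀ z w : 𝔻, RKHS.kernel (RKHS.OfKernel (kernelMatrix b)) z w 1 = dbrKernel b z w :=
    fun z w => by
      rw [RKHS.OfKernel.kernel_ofKernel]
      simp [kernelMatrix]
  refine ⟨RKHS.OfKernel (kernelMatrix b), inferInstance, inferInstance, inferInstance,
    inferInstance, hk, exists_eq_coe_of_bound f (Real.sqrt C) fun c => ?_⟩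
  refine (sq_le_sq₀ (norm_nonneg _) (by positivity)).1 ?_
  rw [mul_pow, Real.sq_sqrt hC]
  refine (h c.support c).trans (mul_le_mul_of_nonneg_left ?_ hC)
  refine (circleAverage_le_kernel_sum hb ha c.support c).trans_eq ?_
  rw [← inner_self_eq_norm_sq (𝕜 := ℂ)]
  simp only [Finsupp.sum, sum_inner, inner_sum, inner_smul_left, inner_smul_right,
    RKHS.kerFun_inner, RKHS.kerFun_apply, hk, Finset.mul_sum]
  rw [Finset.sum_comm]
  change _ = Complex.re _
  congr 1
  refine Finset.sum_congr rfl fun x _ => Finset.sum_congr rfl fun w _ => ?_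
  simp
  ring

/-- The functional `∑ c_w k_w ↦ ∑ c_w conj(f(w))` is bounded by the norm of `a ∑ c_w k_w` in
`L²(𝕋)`, where the `k_w` are the Szegő kernels. -/
def AverageBounded (a : RatFunc ℂ) (f : 𝔻 → ℂ) : Prop :=
  ∃ C : ℝ, 0 ≤ C ∧ ∀ (s : Finset 𝔻) (c : 𝔻 → ℂ), ‖∑ w ∈ s, c w * conj (f w)‖ ^ 2 ≤
      C * Real.circleAverage (fun ζ => ‖ratVal a ζ * szegoSum s c ζ‖ ^ 2) 0 1

theorem AverageBounded.mem_dbrSpace (hb : InUnitBall b) (ha : IsPythagoreanMate b a) {f : 𝔻 → ℂ}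
    (hf : AverageBounded a f) : f ∈ dbrSpace b :=
  let ⟨_, hC, h⟩ := hf
  mem_dbrSpace_of_bound hb ha hC h

theorem sq_norm_add_le {E : Type*} [SeminormedAddCommGroup E] (x y : E) :
    ‖x + y‖ ^ 2 ≤ 2 * ‖x‖ ^ 2 + 2 * ‖y‖ ^ 2 := by
  nlinarith [norm_add_le x y, norm_nonneg (x + y), sq_nonneg (‖x‖ - ‖y‖)]

theorem AverageBounded.add {f g : 𝔻 → ℂ} (hf : AverageBounded a f) (hg : AverageBounded a g) :
    AverageBounded a (f + g) := by
  obtain ⟨C, hC, h⟩ := hf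
  obtain ⟨D, hD, k⟩ := hg
  refine ⟨2 * C + 2 * D, by positivity, fun s c => ?_⟩
  simp only [Pi.add_apply, map_add, mul_add, Finset.sum_add_distrib]
  refine (sq_norm_add_le _ _).trans ?_
  linarith [h s c, k s c]

theorem AverageBounded.const_mul {f : 𝔻 → ℂ} (hf : AverageBounded a f) (d : ℂ) :
    AverageBounded a (fun z => d * f z) := by
  obtain ⟨C, hC, h⟩ := hf
  refine ⟨‖d‖ ^ 2 * C, by positivity, fun s c => ?_⟩
  have : ∑ w ∈ s, c w * conj (d * f w) = conj d * ∑ w ∈ s, c w * conj (f w) := by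
    rw [Finset.mul_sum]
    refine Finset.sum_congr rfl fun w _ => ?_
    rw [map_mul]
    ring
  rw [this, norm_mul, mul_pow, RCLike.norm_conj, mul_assoc]
  exact mul_le_mul_of_nonneg_left (h s c) (by positivity)

theorem circleAverage_sq_nonneg (F : ℂ → ℂ) : 0 ≤ Real.circleAverage (fun ζ => ‖F ζ‖ ^ 2) 0 1 :=
  Real.circleAverage_nonneg_of_nonneg fun _ _ => by positivity

theorem sq_norm_szegoSum_le (ha : IsPythagoreanMate b a) (s : Finset 𝔻) (c : 𝔻 → ℂ) {z : ℂ}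
    (hz : ‖z‖ < 1) : ‖szegoSum s c z‖ ^ 2 ≤ (‖ratVal a z‖ ^ 2)⁻¹ * (1 - ‖z‖)⁻¹ *
      Real.circleAverage (fun ζ => ‖ratVal a ζ * szegoSum s c ζ‖ ^ 2) 0 1 := by
  have h := sq_norm_le_circleAverage (F := fun ζ => ratVal a ζ * szegoSum s c ζ)
    (diffContOnCl_ball_of_differentiableAt fun z hz =>
      (differentiableAt_ratVal (ha.no_pole z hz)).mul (differentiableAt_szegoSum s c hz)) hz
  have hA : ratVal a z ≠ 0 := ha.no_zero (UnitDisc.mk z hz)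
  have hA' : 0 < ‖ratVal a z‖ ^ 2 := by positivity
  rw [norm_mul, mul_pow] at h
  rwa [mul_assoc, inv_mul_eq_div, le_div_iff₀ hA', mul_comm]

theorem averageBounded_szego (ha : IsPythagoreanMate b a) (l : 𝔻) :
    AverageBounded a (fun z => szego l z) := by
  have h0 : 0 < 1 - ‖(l : ℂ)‖ := sub_pos.2 l.norm_lt_one
  refine ⟨(‖ratVal a l‖ ^ 2)⁻¹ * (1 - ‖(l : ℂ)‖)⁻¹, by positivity, fun s c => ?_⟩
  simp only [szego_conj]
  exact sq_norm_szegoSum_le ha s c l.norm_lt_one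

/-- Weighting by `conj(w)` is the backward shift `R ↦ (R - R(0)) / z`. The bound is carried on a
whole disk, not only at the origin, so that dividing by `z` can be undone on its boundary and the
maximum principle recovers the interior. -/
theorem exists_bound_shift_szegoSum (ha : IsPythagoreanMate b a) (n : ℕ) :
    ∃ C : ℝ, 0 ≤ C ∧ ∀ (s : Finset 𝔻) (c : 𝔻 → ℂ) (z : ℂ), ‖z‖ ≤ 1 / 2 →
      ‖szegoSum s (fun w => c w * conj (w : ℂ) ^ n) z‖ ^ 2 ≤
        C * Real.circleAverage (fun ζ => ‖ratVal a ζ * szegoSum s c ζ‖ ^ 2) 0 1 := by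
  induction n with
  | zero =>
    have hcont : ContinuousOn (fun z => (‖ratVal a z‖ ^ 2)⁻¹ * (1 - ‖z‖)⁻¹)
        (closedBall 0 (1 / 2)) := fun z hz => by
      have hz : ‖z‖ < 1 := lt_of_le_of_lt (by simpa using hz) one_half_lt_one
      have hA : ratVal a z ≠ 0 := ha.no_zero (UnitDisc.mk z hz)
      have h1 := (differentiableAt_ratVal (ha.no_pole z hz.le)).continuousAt
      exact (((h1.norm.pow 2).inv₀ (pow_pos (norm_pos_iff.2 hA) 2).ne').mul
        ((continuousAt_const.sub continuous_norm.continuousAt).inv₀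
          (sub_pos.2 hz).ne')).continuousWithinAt
    obtain ⟨C, hC⟩ := (isCompact_closedBall (0 : ℂ) (1 / 2)).bddAbove_image hcont
    refine ⟨max C 0, le_max_right _ _, fun s c z hz => ?_⟩
    simp only [pow_zero, mul_one]
    refine (sq_norm_szegoSum_le ha s c (lt_of_le_of_lt hz one_half_lt_one)).trans ?_
    refine mul_le_mul_of_nonneg_right (le_max_of_le_left ?_) (circleAverage_sq_nonneg _)
    exact hC ⟨z, by simpa using hz, rfl⟩
  | succ n ih =>
    obtain ⟨C, hC, h⟩ := ih
    -- On `|z| = 1/2` division by `z` costs `4`, and `|R - R(0)|²` is at most `2CQ + 2CQ`.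
    refine ⟨16 * C, by positivity, fun s c z hz => ?_⟩
    set Q := Real.circleAverage (fun ζ => ‖ratVal a ζ * szegoSum s c ζ‖ ^ 2) 0 1
    have hQ : 0 ≤ Q := circleAverage_sq_nonneg _
    set R := szegoSum s (fun w => c w * conj (w : ℂ) ^ n) with hR
    set R' := szegoSum s (fun w => c w * conj (w : ℂ) ^ (n + 1)) with hR'
    have hrel : ∀ z, ‖z‖ ≤ 1 → z * R' z = R z - R 0 := fun z hz => by
      simp only [hR, hR', szegoSum, Finset.mul_sum, ← Finset.sum_sub_distrib]
      refine Finset.sum_congr rfl fun w _ => ?_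
      have h1 : szego w z * (1 - conj (w : ℂ) * z) = 1 :=
        inv_mul_cancel₀ (one_sub_conj_mul_ne_zero w.norm_lt_one hz)
      have h2 : szego w 0 = 1 := by simp [szego]
      linear_combination (-(c w * conj (w : ℂ) ^ n)) * h1 + c w * conj (w : ℂ) ^ n * h2
    have hd : DiffContOnCl ℂ R' (ball 0 (1 / 2)) := by
      refine DifferentiableOn.diffContOnCl fun z hz =>
        (differentiableAt_szegoSum _ _ ?_).differentiableWithinAt
      rw [closure_ball _ (by norm_num), mem_closedBall_zero_iff] at hz
      linarith
    have hfr : ∀ ζ ∈ frontier (ball (0 : ℂ) (1 / 2)), ‖R' ζ‖ ≤ Real.sqrt (16 * C * Q) :=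
      fun ζ hζ => by
        rw [frontier_ball _ (by norm_num), mem_sphere_zero_iff_norm] at hζ
        refine Real.le_sqrt_of_sq_le ?_
        have h1 := congrArg (fun x => ‖x‖ ^ 2) (hrel ζ (by linarith))
        simp only [norm_mul, mul_pow, hζ] at h1
        have h2 := sq_norm_add_le (R ζ) (-R 0)
        rw [← sub_eq_add_neg, norm_neg] at h2
        have h3 := h s c ζ hζ.le
        have h4 := h s c 0 (by norm_num)
        linarith
    have hfin := Complex.norm_le_of_forall_mem_frontier_norm_le isBounded_ball hd hfr
      (z := z) (by rw [closure_ball _ (by norm_num)]; simpa using hz)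
    calc ‖R' z‖ ^ 2 ≤ Real.sqrt (16 * C * Q) ^ 2 := by gcongr
      _ = 16 * C * Q := Real.sq_sqrt (by positivity)

theorem averageBounded_pow (ha : IsPythagoreanMate b a) (n : ℕ) :
    AverageBounded a (fun z => (z : ℂ) ^ n) := by
  obtain ⟨C, hC, h⟩ := exists_bound_shift_szegoSum ha n
  refine ⟨C, hC, fun s c => ?_⟩
  simpa [szegoSum, szego] using h s c 0 (by norm_num)

theorem averageBounded_pow_mul_szego (ha : IsPythagoreanMate b a) (l : 𝔻) (n : ℕ) :
    AverageBounded a (fun z => (z : ℂ) ^ n * szego l z) := by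
  by_cases hl : (l : ℂ) = 0
  · simpa [szego, hl] using averageBounded_pow ha n
  induction n with
  | zero => simpa using averageBounded_szego ha l
  | succ n ih =>
    have hl' : conj (l : ℂ) ≠ 0 := by simpa using hl
    -- From `conj(l) z s_l = s_l - 1`; the division is why `l = 0` is treated apart.
    convert! (ih.add ((averageBounded_pow ha n).const_mul (-1))).const_mul (conj (l : ℂ))⁻¹
      using 1
    funext z
    have h1 : szego l z * (1 - conj (l : ℂ) * z) = 1 :=
      inv_mul_cancel₀ (one_sub_conj_mul_ne_zero l.norm_lt_one z.norm_lt_one.le)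
    rw [Pi.add_apply, eq_inv_mul_iff_mul_eq₀ hl']
    linear_combination (-(z : ℂ) ^ n) * h1

theorem averageBounded_polyFun_mul_szego (ha : IsPythagoreanMate b a) (l : 𝔻)
    (p : Polynomial ℂ) : AverageBounded a (fun z => polyFun p z * szego l z) := by
  induction p using Polynomial.induction_on' with
  | add p q hp hq =>
    convert! hp.add hq using 1
    funext z
    simp [polyFun, add_mul]
  | monomial n c =>
    convert! (averageBounded_pow_mul_szego ha l n).const_mul c using 1
    funext z
    simp [polyFun, mul_assoc]

theorem averageBounded_polyFun (ha : IsPythagoreanMate b a) (p : Polynomial ℂ) :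
    AverageBounded a (polyFun p) := by
  convert! averageBounded_polyFun_mul_szego ha 0 p using 1
  funext z
  simp [szego]

end Membership

/-! ### The Hardy norm through Taylor coefficients -/

section Hardy

theorem IsHolomorphic.exists_hasSum {f : 𝔻 → ℂ} (hf : IsHolomorphic f) :
    ∃ c : ℕ → ℂ, ∀ z : 𝔻, HasSum (fun n => c n * (z : ℂ) ^ n) (f z) := by
  obtain ⟨F, hF, hFf⟩ := hf
  refine ⟨fun n => (n.factorial : ℂ)⁻¹ * iteratedDeriv n F 0, fun z => ?_⟩
  have h := Complex.hasSum_taylorSeries_on_ball (c := 0) (r := 1) (f := F) (by simpa using hF)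
    (z := z) (by simpa using z.norm_lt_one)
  rw [hFf]
  convert! h using 1
  funext n
  simp
  ring

theorem IsHolomorphic.continuous_circlePoint {f : 𝔻 → ℂ} (hf : IsHolomorphic f)
    (r : Set.Ioo (0 : ℝ) 1) : Continuous fun θ => f (circlePoint r θ) := by
  obtain ⟨F, hF, hFf⟩ := hf
  simp only [hFf]
  exact hF.continuousOn.comp_continuous (continuous_circleMap 0 r) fun θ => by
    simpa using (circlePoint r θ).norm_lt_one

theorem IsHolomorphic.add {f g : 𝔻 → ℂ} (hf : IsHolomorphic f) (hg : IsHolomorphic g) :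
    IsHolomorphic (f + g) := by
  obtain ⟨F, hF, hFf⟩ := hf
  obtain ⟨G, hG, hGg⟩ := hg
  exact ⟨F + G, hF.add hG, fun z => by simp [hFf, hGg]⟩

theorem IsHolomorphic.mul {f g : 𝔻 → ℂ} (hf : IsHolomorphic f) (hg : IsHolomorphic g) :
    IsHolomorphic (f * g) := by
  obtain ⟨F, hF, hFf⟩ := hf
  obtain ⟨G, hG, hGg⟩ := hg
  exact ⟨F * G, hF.mul hG, fun z => by simp [hFf, hGg]⟩

theorem isHolomorphic_polyFun (p : Polynomial ℂ) : IsHolomorphic (polyFun p) :=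
  ⟨fun z => p.eval z, p.differentiable.differentiableOn, fun _ => rfl⟩

theorem isHolomorphic_szego (l : 𝔻) : IsHolomorphic fun z => szego l z :=
  ⟨szego l, fun z hz => (differentiableAt_szego l.norm_lt_one
    (by simpa using (mem_ball_zero_iff.1 hz).le)).differentiableWithinAt, fun _ => rfl⟩

/-- The quadratic mean over the circle of radius `r`. -/
def meanSq (f : 𝔻 → ℂ) (r : Set.Ioo (0 : ℝ) 1) : ℝ≥0∞ :=
  (ENNReal.ofReal (2 * Real.pi))⁻¹ *
      ∫⁻ θ in Set.Ioc 0 (2 * Real.pi), ‖f (circlePoint r θ)‖ₑ ^ 2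

theorem rpow_half_sq (x : ℝ≥0∞) : (x ^ (1 / 2 : ℝ)) ^ 2 = x := by
  rw [← ENNReal.rpow_natCast, ← ENNReal.rpow_mul]
  norm_num

theorem hardyNorm_sq (f : 𝔻 → ℂ) : hardyNorm f ^ 2 = ⨆ r, meanSq f r := rpow_half_sq _

/-- Parseval's identity for an absolutely convergent power series on the unit circle. -/
theorem hasSum_sq_norm_circleAverage {u : ℕ → ℂ} (hu : Summable fun n => ‖u n‖) :
    HasSum (fun n => ‖u n‖ ^ 2)
      (Real.circleAverage (fun ζ => ‖∑' n, u n * ζ ^ n‖ ^ 2) 0 1) := by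
  have hbd : ∀ θ n, ‖u n * (circleMap 0 1 θ) ^ n‖ = ‖u n‖ := fun θ n => by simp
  have hsum : ∀ θ, HasSum (fun n => u n * (circleMap 0 1 θ) ^ n)
      (∑' n, u n * (circleMap 0 1 θ) ^ n) := fun θ =>
    (Summable.of_norm (by simpa only [hbd] using hu)).hasSum
  have hpart : ∀ M, ∑ n ∈ Finset.range M, ‖u n‖ ^ 2 =
      Real.circleAverage (fun ζ => ‖∑ n ∈ Finset.range M, u n * ζ ^ n‖ ^ 2) 0 1 := fun M => by
    have h := (∑ n ∈ Finset.range M, Polynomial.monomial n (u n)).sum_sq_norm_coeff_eq_circleAverage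
    have hco : ∀ i, (∑ n ∈ Finset.range M, Polynomial.monomial n (u n)).coeff i =
        if i ∈ Finset.range M then u i else 0 := fun i => by
      simp [Polynomial.coeff_monomial]
    simp only [Polynomial.eval_finsetSum, Polynomial.eval_monomial] at h
    rw [← h]
    symm
    refine (Finset.sum_subset (fun i hi => ?_) fun i _ hi => ?_).trans
      (Finset.sum_congr rfl fun i hi => ?_)
    · by_contra hM
      rw [Polynomial.mem_support_iff, hco, if_neg hM] at hi
      exact hi rfl
    · rw [Polynomial.notMem_support_iff.1 hi]
      simp
    · rw [hco, if_pos hi]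
  rw [hasSum_iff_tendsto_nat_of_nonneg fun n => by positivity]
  simp only [hpart, Real.circleAverage_def]
  refine Tendsto.const_smul ?_ _
  -- The identity for polynomials passes to the limit, the partial sums being dominated by `∑ ‖u
  -- n‖`.
  refine intervalIntegral.tendsto_integral_filter_of_dominated_convergence
    (fun _ => (∑' n, ‖u n‖) ^ 2) (Eventually.of_forall fun M => ?_)
    (Eventually.of_forall fun M => Eventually.of_forall fun θ _ => ?_)
    intervalIntegrable_const (Eventually.of_forall fun θ _ => ?_)
  · exact Continuous.aestronglyMeasurable (by fun_prop)
  · rw [Real.norm_of_nonneg (by positivity)]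
    gcongr
    refine (norm_sum_le _ _).trans ?_
    simp only [hbd]
    exact hu.sum_le_tsum _ fun _ _ => norm_nonneg _
  · exact (hsum θ).tendsto_sum_nat.norm.pow 2

theorem meanSq_eq_tsum {f : 𝔻 → ℂ} {c : ℕ → ℂ}
    (hc : ∀ z : 𝔻, HasSum (fun n => c n * (z : ℂ) ^ n) (f z)) (r : Set.Ioo (0 : ℝ) 1) :
    meanSq f r = ∑' n, ‖c n * ((r : ℝ) : ℂ) ^ n‖ₑ ^ 2 := by
  set u : ℕ → ℂ := fun n => c n * ((r : ℝ) : ℂ) ^ n with hu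
  have hr : ‖((r : ℝ) : ℂ)‖ < 1 := by
    rw [Complex.norm_real, Real.norm_of_nonneg r.2.1.le]
    exact r.2.2
  have hsu : Summable fun n => ‖u n‖ := (hc (UnitDisc.mk _ hr)).summable.norm
  have hP := hasSum_sq_norm_circleAverage hsu
  have hf : ∀ θ, f (circlePoint r θ) = ∑' n, u n * (circleMap 0 1 θ) ^ n := fun θ => by
    rw [← (hc (circlePoint r θ)).tsum_eq]
    refine tsum_congr fun n => ?_
    simp only [circlePoint, UnitDisc.coe_mk, hu, circleMap]
    simp
    ring
  have hcont : Continuous fun θ : ℝ => ∑' n, u n * (circleMap 0 1 θ) ^ n := by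
    refine continuous_tsum (fun n => by fun_prop) hsu fun n θ => ?_
    simp
  have h1 : ∑' n, ‖u n‖ₑ ^ 2 = ENNReal.ofReal (∑' n, ‖u n‖ ^ 2) := by
    rw [ENNReal.ofReal_tsum_of_nonneg (fun _ => by positivity) hP.summable]
    refine tsum_congr fun n => ?_
    rw [ENNReal.ofReal_pow (norm_nonneg _), ofReal_norm]
  rw [h1, hP.tsum_eq, Real.circleAverage_def, smul_eq_mul, ENNReal.ofReal_mul (by positivity),
    ENNReal.ofReal_inv_of_pos (by positivity), meanSq,
    intervalIntegral.integral_of_le (by positivity),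
    ofReal_integral_eq_lintegral_ofReal]
  · congr 1
    refine lintegral_congr fun θ => ?_
    rw [hf, ENNReal.ofReal_pow (norm_nonneg _), ofReal_norm]
  · exact ((hcont.norm.pow 2).intervalIntegrable 0 (2 * Real.pi)).1
  · exact Eventually.of_forall fun θ => by positivity

theorem hardyNorm_sq_eq_tsum {f : 𝔻 → ℂ} {c : ℕ → ℂ}
    (hc : ∀ z : 𝔻, HasSum (fun n => c n * (z : ℂ) ^ n) (f z)) :
    hardyNorm f ^ 2 = ∑' n, ‖c n‖ₑ ^ 2 := by
  rw [hardyNorm_sq]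
  refine le_antisymm (iSup_le fun r => ?_) ?_
  · rw [meanSq_eq_tsum hc]
    refine ENNReal.tsum_le_tsum fun n => ?_
    gcongr
    rw [← ofReal_norm, ← ofReal_norm]
    refine ENNReal.ofReal_le_ofReal ?_
    rw [norm_mul, norm_pow, Complex.norm_real, Real.norm_of_nonneg r.2.1.le]
    exact mul_le_of_le_one_right (norm_nonneg _) (pow_le_one₀ r.2.1.le r.2.2.le)
  · rw [ENNReal.tsum_eq_iSup_nat]
    refine iSup_le fun M => ?_
    have ht : Tendsto (fun r : ℝ => ∑ n ∈ Finset.range M, ‖c n * (r : ℂ) ^ n‖ₑ ^ 2) (𝓝[<] 1)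
        (𝓝 (∑ n ∈ Finset.range M, ‖c n‖ₑ ^ 2)) := by
      have hcont : Continuous fun r : ℝ => ∑ n ∈ Finset.range M, ‖c n * (r : ℂ) ^ n‖ₑ ^ 2 :=
        continuous_finsetSum _ fun n _ => 
          (ENNReal.continuous_pow 2).comp (by fun_prop)
      have := (hcont.tendsto 1).mono_left (nhdsWithin_le_nhds (s := Set.Iio 1))
      simpa using this
    refine le_of_tendsto ht ?_
    filter_upwards [Ioo_mem_nhdsLT (zero_lt_one : (0 : ℝ) < 1)] with r hr
    refine le_trans ?_ (le_iSup _ (⟨r, hr⟩ : Set.Ioo (0 : ℝ) 1))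
    rw [meanSq_eq_tsum hc]
    exact ENNReal.sum_le_tsum _

/-- Monotonicity in the radius allows the supremum over radii to be exchanged with finite sums over
`j` in `tsum_hardyNorm_sq_mul_le`. -/
theorem meanSq_mono {f : 𝔻 → ℂ} (hf : IsHolomorphic f) : Monotone (meanSq f) := by
  obtain ⟨c, hc⟩ := hf.exists_hasSum
  intro r r' hrr
  rw [meanSq_eq_tsum hc, meanSq_eq_tsum hc]
  refine ENNReal.tsum_le_tsum fun n => ?_
  gcongr
  rw [← ofReal_norm, ← ofReal_norm]
  refine ENNReal.ofReal_le_ofReal ?_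
  simp only [norm_mul, norm_pow, Complex.norm_real]
  rw [Real.norm_of_nonneg r.2.1.le, Real.norm_of_nonneg r'.2.1.le]
  have := r.2.1.le
  have : (r : ℝ) ≤ r' := hrr
  gcongr

theorem hasSum_polyFun (p : Polynomial ℂ) (z : 𝔻) :
    HasSum (fun n => p.coeff n * (z : ℂ) ^ n) (polyFun p z) := by
  rw [polyFun, Polynomial.eval_eq_sum, Polynomial.sum]
  refine hasSum_sum_of_ne_finset_zero fun n hn => ?_
  rw [Polynomial.notMem_support_iff.1 hn, zero_mul]

theorem hardyNorm_polyFun_sq (p : Polynomial ℂ) :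
    hardyNorm (polyFun p) ^ 2 = ∑' n, ‖p.coeff n‖ₑ ^ 2 :=
  hardyNorm_sq_eq_tsum (hasSum_polyFun p)

theorem enorm_coeff_le_hardyNorm (p : Polynomial ℂ) (n : ℕ) :
    ‖p.coeff n‖ₑ ^ 2 ≤ hardyNorm (polyFun p) ^ 2 := by
  rw [hardyNorm_polyFun_sq]
  exact ENNReal.le_tsum n

theorem hardyNorm_polyFun_sq_lt_top (p : Polynomial ℂ) : hardyNorm (polyFun p) ^ 2 < ∞ := by
  rw [hardyNorm_polyFun_sq, tsum_eq_sum (s := p.support) fun n hn => by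
    rw [Polynomial.notMem_support_iff.1 hn]; simp]
  exact ENNReal.sum_lt_top.2 fun n _ => ENNReal.pow_lt_top enorm_lt_top

theorem lt_top_of_sq_lt_top {x : ℝ≥0∞} (h : x ^ 2 < ∞) : x < ∞ := by
  by_contra hx
  rw [not_lt_top_iff] at hx
  simp [hx] at h

theorem polyFun_mem_hardySpace (p : Polynomial ℂ) : polyFun p ∈ hardySpace :=
  ⟨isHolomorphic_polyFun p, lt_top_of_sq_lt_top (hardyNorm_polyFun_sq_lt_top p)⟩

theorem hardyNorm_sq_add_le {f g : 𝔻 → ℂ} (hf : IsHolomorphic f) :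
    hardyNorm (f + g) ^ 2 ≤ 2 * hardyNorm f ^ 2 + 2 * hardyNorm g ^ 2 := by
  rw [hardyNorm_sq]
  refine iSup_le fun r => ?_
  have h : meanSq (f + g) r ≤ 2 * meanSq f r + 2 * meanSq g r := by
    simp only [meanSq, mul_left_comm (2 : ℝ≥0∞), ← mul_add]
    gcongr
    rw [mul_add, ← lintegral_const_mul' _ _ ENNReal.ofNat_ne_top,
      ← lintegral_const_mul' _ _ ENNReal.ofNat_ne_top, ← lintegral_add_left
      (((hf.continuous_circlePoint r).measurable.enorm.pow_const 2).const_mul _)]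
    refine lintegral_mono fun θ => ?_
    have := sq_norm_add_le (f (circlePoint r θ)) (g (circlePoint r θ))
    simp only [Pi.add_apply, ← ofReal_norm]
    rw [← ENNReal.ofReal_pow (norm_nonneg _), ← ENNReal.ofReal_pow (norm_nonneg _),
      ← ENNReal.ofReal_pow (norm_nonneg _), ← ENNReal.ofReal_ofNat, ← ENNReal.ofReal_mul (by simp),
      ← ENNReal.ofReal_mul (by simp), ← ENNReal.ofReal_add (by positivity) (by positivity)]
    exact ENNReal.ofReal_le_ofReal this
  refine h.trans ?_
  rw [hardyNorm_sq, hardyNorm_sq]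
  gcongr <;> exact le_iSup _ r

theorem tsum_hardyNorm_sq_mul_le {φ : ℕ → 𝔻 → ℂ} (hφ : ∀ j, IsHolomorphic (φ j)) {g : 𝔻 → ℂ}
    (hg : IsHolomorphic g) {C : ℝ≥0∞} (hC : C ≠ ∞) (h : ∀ z, ∑' j, ‖φ j z‖ₑ ^ 2 ≤ C) :
    ∑' j, hardyNorm (φ j * g) ^ 2 ≤ C * hardyNorm g ^ 2 := by
  simp only [hardyNorm_sq]
  rw [ENNReal.tsum_eq_iSup_sum]
  refine iSup_le fun s => ?_
  rw [ENNReal.finsetSum_iSup_of_monotone fun j => meanSq_mono ((hφ j).mul hg)]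
  refine iSup_le fun r => (ENNReal.sum_le_tsum s).trans ?_
  have key : ∑' j, meanSq (φ j * g) r ≤ C * meanSq g r := by
    simp only [meanSq, ENNReal.tsum_mul_left, mul_left_comm C]
    gcongr
    rw [← lintegral_tsum fun j => by
      have := (((hφ j).mul hg).continuous_circlePoint r).measurable
      exact (this.enorm.pow_const 2).aemeasurable, ← lintegral_const_mul' _ _ hC]
    refine lintegral_mono fun θ => ?_
    simp only [Pi.mul_apply, enorm_mul, mul_pow, ENNReal.tsum_mul_right]
    exact mul_le_mul_left (h _) _
  exact key.trans (mul_le_mul_right (le_iSup _ r) _)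

theorem hardyNorm_sq_mul_le {φ g : 𝔻 → ℂ} {C : ℝ≥0∞} (hC : C ≠ ∞) (h : ∀ z, ‖φ z‖ₑ ^ 2 ≤ C) :
    hardyNorm (φ * g) ^ 2 ≤ C * hardyNorm g ^ 2 := by
  rw [hardyNorm_sq, hardyNorm_sq]
  refine iSup_le fun r => ?_
  have key : meanSq (φ * g) r ≤ C * meanSq g r := by
    simp only [meanSq, mul_left_comm C]
    gcongr
    rw [← lintegral_const_mul' _ _ hC]
    refine lintegral_mono fun θ => ?_
    simp only [Pi.mul_apply, enorm_mul, mul_pow]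
    exact mul_le_mul_left (h _) _
  exact key.trans (mul_le_mul_right (le_iSup _ r) _)

theorem add_mem_hardySpace {f g : 𝔻 → ℂ} (hf : f ∈ hardySpace) (hg : g ∈ hardySpace) :
    f + g ∈ hardySpace := by
  refine ⟨hf.1.add hg.1, lt_top_of_sq_lt_top ((hardyNorm_sq_add_le hf.1).trans_lt ?_)⟩
  exact ENNReal.add_lt_top.2 ⟨ENNReal.mul_lt_top (by simp) (ENNReal.pow_lt_top hf.2),
    ENNReal.mul_lt_top (by simp) (ENNReal.pow_lt_top hg.2)⟩

theorem mul_mem_hardySpace {φ g : 𝔻 → ℂ} (hφ : IsHolomorphic φ) {C : ℝ≥0∞} (hC : C ≠ ∞)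
    (h : ∀ z, ‖φ z‖ₑ ^ 2 ≤ C) (hg : g ∈ hardySpace) : φ * g ∈ hardySpace :=
  ⟨hφ.mul hg.1, lt_top_of_sq_lt_top ((hardyNorm_sq_mul_le hC h).trans_lt
    (ENNReal.mul_lt_top hC.lt_top (ENNReal.pow_lt_top hg.2)))⟩

theorem hasSum_szego (l z : 𝔻) : HasSum (fun n => conj (l : ℂ) ^ n * (z : ℂ) ^ n) (szego l z) := by
  simp only [← mul_pow]
  refine hasSum_geometric_of_norm_lt_one ?_
  rw [norm_mul, RCLike.norm_conj]
  nlinarith [l.norm_lt_one, z.norm_lt_one, norm_nonneg (l : ℂ), norm_nonneg (z : ℂ)]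

theorem hardyNorm_szego_sq (l : 𝔻) :
    hardyNorm (fun z => szego l z) ^ 2 = ENNReal.ofReal (1 - ‖(l : ℂ)‖ ^ 2)⁻¹ := by
  have h := hasSum_geometric_of_lt_one (sq_nonneg ‖(l : ℂ)‖) l.sq_norm_lt_one
  rw [hardyNorm_sq_eq_tsum (hasSum_szego l), ← h.tsum_eq,
    ENNReal.ofReal_tsum_of_nonneg (fun _ => by positivity) h.summable]
  refine tsum_congr fun n => ?_
  rw [← ofReal_norm, ← ENNReal.ofReal_pow (norm_nonneg _), norm_pow, RCLike.norm_conj, ← pow_mul,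
    ← pow_mul, mul_comm]

theorem szego_mem_hardySpace (l : 𝔻) : (fun z : 𝔻 => szego l z) ∈ hardySpace :=
  ⟨isHolomorphic_szego l, lt_top_of_sq_lt_top (by
    rw [hardyNorm_szego_sq]; exact ENNReal.ofReal_lt_top)⟩

theorem sq_norm_sum_mul_le (s : Finset ℕ) (c d : ℕ → ℂ) :
    ‖∑ n ∈ s, c n * d n‖ ^ 2 ≤ (∑ n ∈ s, ‖c n‖ ^ 2) * ∑ n ∈ s, ‖d n‖ ^ 2 := by
  refine le_trans ?_ (Finset.sum_mul_sq_le_sq_mul_sq s (fun n => ‖c n‖) fun n => ‖d n‖)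
  gcongr
  refine (norm_sum_le _ _).trans_eq ?_
  simp only [norm_mul]

theorem sum_sq_norm_le_of_hasSum {f : 𝔻 → ℂ} {c : ℕ → ℂ}
    (hc : ∀ z : 𝔻, HasSum (fun n => c n * (z : ℂ) ^ n) (f z)) (hf : hardyNorm f < ∞)
    (s : Finset ℕ) : ∑ n ∈ s, ‖c n‖ ^ 2 ≤ (hardyNorm f).toReal ^ 2 := by
  rw [← ENNReal.toReal_pow]
  refine (ENNReal.ofReal_le_iff_le_toReal (ENNReal.pow_lt_top hf).ne).1 ?_
  rw [hardyNorm_sq_eq_tsum hc, ENNReal.ofReal_sum_of_nonneg fun _ _ => by positivity]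
  simp only [ENNReal.ofReal_pow (norm_nonneg _), ofReal_norm]
  exact ENNReal.sum_le_tsum s

theorem sq_norm_apply_le {g : 𝔻 → ℂ} (hg : g ∈ hardySpace) (z : 𝔻) :
    ‖g z‖ ^ 2 ≤ (hardyNorm g).toReal ^ 2 * (1 - ‖(z : ℂ)‖ ^ 2)⁻¹ := by
  obtain ⟨c, hc⟩ := hg.1.exists_hasSum
  refine le_of_tendsto ((hc z).tendsto_sum_nat.norm.pow 2) (Eventually.of_forall fun M => ?_)
  refine (sq_norm_sum_mul_le _ _ _).trans ?_
  have h := hasSum_geometric_of_lt_one (sq_nonneg ‖(z : ℂ)‖) z.sq_norm_lt_one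
  refine mul_le_mul (sum_sq_norm_le_of_hasSum hc hg.2 _) ?_ (by positivity) (by positivity)
  rw [← h.tsum_eq]
  refine le_trans (le_of_eq ?_) (h.summable.sum_le_tsum (Finset.range M) fun _ _ => by positivity)
  refine Finset.sum_congr rfl fun n _ => ?_
  rw [norm_pow, ← pow_mul, ← pow_mul, mul_comm]

theorem sq_norm_polyFun_le {N : ℕ} {p : Polynomial ℂ} (hp : p ∈ Polynomial.degreeLT ℂ N) (z : 𝔻) :
    ‖polyFun p z‖ ^ 2 ≤
      (hardyNorm (polyFun p)).toReal ^ 2 * ∑ i ∈ Finset.range N, (‖(z : ℂ)‖ ^ 2) ^ i := by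
  have h1 : polyFun p z = ∑ i ∈ Finset.range N, p.coeff i * (z : ℂ) ^ i := by
    refine (hasSum_polyFun p z).unique (hasSum_sum_of_ne_finset_zero fun n hn => ?_)
    rw [Polynomial.mem_degreeLT, Polynomial.degree_lt_iff_coeff_zero] at hp
    rw [hp n (by simpa using hn), zero_mul]
  rw [h1]
  refine (sq_norm_sum_mul_le _ _ _).trans (mul_le_mul
    (sum_sq_norm_le_of_hasSum (hasSum_polyFun p) (polyFun_mem_hardySpace p).2 _) (le_of_eq ?_)
    (by positivity) (by positivity))
  refine Finset.sum_congr rfl fun n _ => ?_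
  rw [norm_pow, ← pow_mul, ← pow_mul, mul_comm]

end Hardy

/-! ### The equivalent norm, and existence of `C₁` -/

section DbrNorm

variable {a : RatFunc ℂ}

theorem dbrNorm_sq (a : RatFunc ℂ) (f : 𝔻 → ℂ) : dbrNorm a f ^ 2 =
    ⨅ (g : 𝔻 → ℂ) (p : Polynomial ℂ) (_ : IsDecomposition a f g p),
      (hardyNorm g ^ 2 + hardyNorm (polyFun p) ^ 2) := rpow_half_sq _

theorem IsDecomposition.dbrNorm_sq_le {f g : 𝔻 → ℂ} {p : Polynomial ℂ}
    (h : IsDecomposition a f g p) :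
    dbrNorm a f ^ 2 ≤ hardyNorm g ^ 2 + hardyNorm (polyFun p) ^ 2 := by
  rw [dbrNorm_sq]
  exact iInf_le_of_le g (iInf_le_of_le p (iInf_le _ h))

/-- Bounds are checked on every decomposition, so uniqueness is never needed. If there is none, the
right side is `∞`, which requires `C ≠ 0` because `0 * ∞ = 0`. -/
theorem le_mul_dbrNorm_sq {f : 𝔻 → ℂ} {x C : ℝ≥0∞} (h0 : C ≠ 0) (hC : C ≠ ∞)
    (h : ∀ g p, IsDecomposition a f g p → x ≤ C * (hardyNorm g ^ 2 + hardyNorm (polyFun p) ^ 2)) :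
    x ≤ C * dbrNorm a f ^ 2 := by
  rw [mul_comm, ← ENNReal.div_le_iff h0 hC, dbrNorm_sq]
  refine le_iInf fun g => le_iInf fun p => le_iInf fun hd => ?_
  rw [ENNReal.div_le_iff h0 hC, mul_comm]
  exact h g p hd

theorem exists_isDecomposition {f : 𝔻 → ℂ} (hf : dbrNorm a f < ∞) :
    ∃ g p, IsDecomposition a f g p := by
  by_contra! h
  have : dbrNorm a f ^ 2 = ∞ := by
    rw [dbrNorm_sq]
    simp [h]
  exact absurd (ENNReal.pow_lt_top (n := 2) hf) (by simp [this])

theorem IsDecomposition.isHolomorphic {f g : 𝔻 → ℂ} {p : Polynomial ℂ}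
    (h : IsDecomposition a f g p) : IsHolomorphic f := by
  rw [h.2.2]
  exact ((isHolomorphic_polyFun _).mul h.1.1).add (isHolomorphic_polyFun p)

theorem polyFun_zero : polyFun 0 = 0 := by
  funext z
  simp [polyFun]

theorem polyFun_add (p q : Polynomial ℂ) : polyFun (p + q) = polyFun p + polyFun q := by
  funext z
  simp [polyFun]

theorem polyFun_mul (p q : Polynomial ℂ) : polyFun (p * q) = polyFun p * polyFun q := by
  funext z
  simp [polyFun]

theorem hardyNorm_zero_sq : hardyNorm 0 ^ 2 = 0 := by
  rw [← polyFun_zero, hardyNorm_polyFun_sq]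
  simp

theorem isDecomposition_mul_boundaryPoly {g : 𝔻 → ℂ} (hg : g ∈ hardySpace) :
    IsDecomposition a (polyFun (boundaryPoly a) * g) g 0 :=
  ⟨hg, Submodule.zero_mem _, by rw [polyFun_zero, add_zero]⟩

theorem zero_mem_hardySpace : (0 : 𝔻 → ℂ) ∈ hardySpace :=
  polyFun_zero ▸ polyFun_mem_hardySpace 0

theorem isDecomposition_polyFun {p : Polynomial ℂ}
    (hp : p ∈ Polynomial.degreeLT ℂ (boundaryDeg a)) : IsDecomposition a (polyFun p) 0 p :=
  ⟨zero_mem_hardySpace, hp, by rw [mul_zero, zero_add]⟩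

theorem dbrNorm_zero : dbrNorm a 0 = 0 := by
  have h := (isDecomposition_mul_boundaryPoly (a := a) zero_mem_hardySpace).dbrNorm_sq_le
  rw [mul_zero, polyFun_zero, hardyNorm_zero_sq, add_zero, nonpos_iff_eq_zero] at h
  simpa using h

theorem IsDecomposition.add {f g f' g' : 𝔻 → ℂ} {p p' : Polynomial ℂ}
    (h : IsDecomposition a f g p) (h' : IsDecomposition a f' g' p') :
    IsDecomposition a (f + f') (g + g') (p + p') :=
  ⟨add_mem_hardySpace h.1 h'.1, Submodule.add_mem _ h.2.1 h'.2.1, by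
    rw [h.2.2, h'.2.2, polyFun_add]
    ring⟩

theorem dbrNorm_sq_add_le (f g : 𝔻 → ℂ) :
    dbrNorm a (f + g) ^ 2 ≤ 2 * dbrNorm a f ^ 2 + 2 * dbrNorm a g ^ 2 := by
  -- Truncated subtraction isolates one norm at a time, so that each infimum is handled separately.
  rw [← tsub_le_iff_left]
  refine le_mul_dbrNorm_sq two_ne_zero ENNReal.ofNat_ne_top fun u p hup => ?_
  rw [tsub_le_iff_left, ← tsub_le_iff_right]
  refine le_mul_dbrNorm_sq two_ne_zero ENNReal.ofNat_ne_top fun v q hvq => ?_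
  rw [tsub_le_iff_right]
  refine (hvq.add hup).dbrNorm_sq_le.trans ?_
  rw [polyFun_add]
  refine (add_le_add (hardyNorm_sq_add_le hvq.1.1)
    (hardyNorm_sq_add_le (isHolomorphic_polyFun q))).trans_eq ?_
  ring

theorem isHolomorphic_const (c : ℂ) : IsHolomorphic fun _ => c :=
  ⟨fun _ => c, differentiableOn_const c, fun _ => rfl⟩

theorem polyFun_C (c : ℂ) : polyFun (Polynomial.C c) = fun _ => c := by
  funext z
  simp [polyFun]

theorem hardyNorm_sq_const_mul_le (c : ℂ) (g : 𝔻 → ℂ) :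
    hardyNorm ((fun _ => c) * g) ^ 2 ≤ ‖c‖ₑ ^ 2 * hardyNorm g ^ 2 :=
  hardyNorm_sq_mul_le (ENNReal.pow_ne_top enorm_ne_top) fun _ => le_rfl

theorem dbrNorm_sq_const_mul_le (c : ℂ) (f : 𝔻 → ℂ) :
    dbrNorm a ((fun _ => c) * f) ^ 2 ≤ ‖c‖ₑ ^ 2 * dbrNorm a f ^ 2 := by
  by_cases hc : c = 0
  · have : (fun _ => c) * f = 0 := by
      funext z
      simp [hc]
    simp [this, dbrNorm_zero]
  refine le_mul_dbrNorm_sq (by simpa using hc) (ENNReal.pow_ne_top enorm_ne_top) fun g p h => ?_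
  have hd : IsDecomposition a ((fun _ => c) * f) ((fun _ => c) * g) (Polynomial.C c * p) :=
    ⟨mul_mem_hardySpace (isHolomorphic_const c) (ENNReal.pow_ne_top enorm_ne_top)
      (fun _ => le_rfl) h.1, by
      rw [← Polynomial.smul_eq_C_mul]
      exact Submodule.smul_mem _ _ h.2.1, by
      rw [h.2.2, polyFun_mul, polyFun_C]
      ring⟩
  refine hd.dbrNorm_sq_le.trans ?_
  rw [polyFun_mul, polyFun_C, mul_add]
  exact add_le_add (hardyNorm_sq_const_mul_le _ _) (hardyNorm_sq_const_mul_le _ _)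

theorem boundaryPoly_monic (a : RatFunc ℂ) : (boundaryPoly a).Monic :=
  Polynomial.monic_multiset_prod_of_monic _ _ fun ξ _ => Polynomial.monic_X_sub_C ξ

/-- Division of `X * q` by the boundary polynomial, for `deg q < N`. -/
theorem exists_X_mul_sub_mem_degreeLT {q : Polynomial ℂ}
    (hq : q ∈ Polynomial.degreeLT ℂ (boundaryDeg a)) :
    ∃ c : ℂ, ‖c‖ₑ ^ 2 ≤ hardyNorm (polyFun q) ^ 2 ∧
      Polynomial.X * q + Polynomial.C (-c) * boundaryPoly a ∈
        Polynomial.degreeLT ℂ (boundaryDeg a) := by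
  rcases hN : boundaryDeg a with _ | k
  · refine ⟨0, by simp, ?_⟩
    rw [hN, Polynomial.mem_degreeLT, Polynomial.degree_lt_iff_coeff_zero] at hq
    have : q = 0 := Polynomial.ext fun n => by simpa using hq n (Nat.zero_le n)
    simp [this]
  -- The coefficient of degree `N - 1` becomes that of `z^N` in `z q`; subtracting this multiple of
  -- the monic `a₁` cancels it.
  · refine ⟨q.coeff k, enorm_coeff_le_hardyNorm q k, ?_⟩
    rw [hN, Polynomial.mem_degreeLT, Polynomial.degree_lt_iff_coeff_zero] at hq
    rw [Polynomial.mem_degreeLT, Polynomial.degree_lt_iff_coeff_zero]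
    intro m hm
    obtain ⟨j, rfl⟩ : ∃ j, m = j + 1 := ⟨m - 1, by omega⟩
    rw [Polynomial.coeff_add, Polynomial.coeff_X_mul, Polynomial.coeff_C_mul]
    rcases eq_or_lt_of_le hm with h | h
    · obtain rfl : k = j := by omega
      have : (boundaryPoly a).coeff (k + 1) = 1 := by
        have := (boundaryPoly_monic a).coeff_natDegree
        rwa [show (boundaryPoly a).natDegree = k + 1 from hN] at this
      rw [this]
      ring
    · rw [hq j (by omega), Polynomial.coeff_eq_zero_of_natDegree_lt (p := boundaryPoly a)]
      · ring
      · rw [show (boundaryPoly a).natDegree = k + 1 from hN]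
        exact h

theorem hardyNorm_sq_X_mul_le (g : 𝔻 → ℂ) :
    hardyNorm (polyFun Polynomial.X * g) ^ 2 ≤ hardyNorm g ^ 2 := by
  refine (hardyNorm_sq_mul_le ENNReal.one_ne_top fun z => ?_).trans_eq (one_mul _)
  rw [← ofReal_norm, ← ENNReal.ofReal_pow (norm_nonneg _), ← ENNReal.ofReal_one]
  refine ENNReal.ofReal_le_ofReal ?_
  simpa [polyFun] using z.sq_norm_lt_one.le

theorem exists_dbrNorm_sq_X_mul_le (a : RatFunc ℂ) : ∃ D : ℝ≥0∞, D ≠ ∞ ∧ ∀ f,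
    dbrNorm a (polyFun Polynomial.X * f) ^ 2 ≤ D * dbrNorm a f ^ 2 := by
  have hfin := (hardyNorm_polyFun_sq_lt_top (boundaryPoly a)).ne
  have hD : 4 + 2 * hardyNorm (polyFun (boundaryPoly a)) ^ 2 ≠ ∞ :=
    ENNReal.add_ne_top.2 ⟨by simp, ENNReal.mul_ne_top (by simp) hfin⟩
  refine ⟨_, hD, fun f => le_mul_dbrNorm_sq (by simp) hD fun g q h => ?_⟩
  obtain ⟨c, hc, hr⟩ := exists_X_mul_sub_mem_degreeLT h.2.1
  have hX : ∀ z, ‖polyFun Polynomial.X z‖ₑ ^ 2 ≤ 1 := fun z => by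
    rw [← ofReal_norm, ← ENNReal.ofReal_pow (norm_nonneg _), ← ENNReal.ofReal_one]
    refine ENNReal.ofReal_le_ofReal ?_
    simpa [polyFun] using z.sq_norm_lt_one.le
  -- The multiple `c a₁` removed from `z q` reappears as the constant `c` added to `z g`.
  have hd : IsDecomposition a (polyFun Polynomial.X * f)
      (polyFun Polynomial.X * g + polyFun (Polynomial.C c))
      (Polynomial.X * q + Polynomial.C (-c) * boundaryPoly a) := by
    refine ⟨add_mem_hardySpace (mul_mem_hardySpace (isHolomorphic_polyFun _) ENNReal.one_ne_top
      hX h.1) (polyFun_mem_hardySpace _), hr, ?_⟩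
    rw [h.2.2]
    funext z
    simp [polyFun]
    ring
  refine hd.dbrNorm_sq_le.trans ?_
  have hconst : hardyNorm (polyFun (Polynomial.C c)) ^ 2 ≤ ‖c‖ₑ ^ 2 := by
    rw [hardyNorm_polyFun_sq, tsum_eq_single 0 fun n hn => by simp [Polynomial.coeff_C, hn]]
    simp
  have h1 : hardyNorm (polyFun Polynomial.X * g + polyFun (Polynomial.C c)) ^ 2 ≤
      2 * hardyNorm g ^ 2 + 2 * hardyNorm (polyFun q) ^ 2 := by
    refine (hardyNorm_sq_add_le ((isHolomorphic_polyFun _).mul h.1.1)).trans ?_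
    have := hardyNorm_sq_X_mul_le g
    have := hconst.trans hc
    gcongr
  have h2 : hardyNorm (polyFun (Polynomial.X * q + Polynomial.C (-c) * boundaryPoly a)) ^ 2 ≤
      2 * hardyNorm (polyFun q) ^ 2 +
        2 * (hardyNorm (polyFun q) ^ 2 * hardyNorm (polyFun (boundaryPoly a)) ^ 2) := by
    rw [polyFun_add, polyFun_mul, polyFun_mul, polyFun_C]
    refine (hardyNorm_sq_add_le
      ((isHolomorphic_polyFun _).mul (isHolomorphic_polyFun _))).trans ?_
    have h3 := hardyNorm_sq_X_mul_le (polyFun q)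
    have h4 := hardyNorm_sq_const_mul_le (-c) (polyFun (boundaryPoly a))
    rw [enorm_neg] at h4
    have h5 := h4.trans (mul_le_mul_left hc _)
    gcongr
  refine (add_le_add h1 h2).trans ?_
  rw [mul_add, add_mul, add_mul]
  calc _ = 2 * hardyNorm g ^ 2 + (4 * hardyNorm (polyFun q) ^ 2 +
        2 * hardyNorm (polyFun (boundaryPoly a)) ^ 2 * hardyNorm (polyFun q) ^ 2) := by ring
    _ ≤ _ := by
      refine add_le_add (le_add_right ?_) le_rfl
      gcongr
      norm_num

theorem hardyNorm_divX_sq_le (p : Polynomial ℂ) :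
    hardyNorm (polyFun p.divX) ^ 2 ≤ hardyNorm (polyFun p) ^ 2 := by
  rw [hardyNorm_polyFun_sq, hardyNorm_polyFun_sq]
  simp only [Polynomial.coeff_divX]
  exact ENNReal.tsum_comp_le_tsum_of_injective (add_left_injective 1) fun n => ‖p.coeff n‖ₑ ^ 2

/-- Horner's scheme `p = z · divX p + p(0)`: each degree costs one multiplication by `z`, and
neither piece exceeds `p` in Hardy norm. -/
theorem exists_dbrNorm_sq_polyFun_mul_le (a : RatFunc ℂ) (n : ℕ) : ∃ C : ℝ≥0∞, C ≠ ∞ ∧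
    ∀ p ∈ Polynomial.degreeLT ℂ n, ∀ f,
      dbrNorm a (polyFun p * f) ^ 2 ≤ C * hardyNorm (polyFun p) ^ 2 * dbrNorm a f ^ 2 := by
  obtain ⟨D, hD, hDf⟩ := exists_dbrNorm_sq_X_mul_le a
  induction n with
  | zero =>
    refine ⟨0, by simp, fun p hp f => ?_⟩
    rw [Polynomial.mem_degreeLT, Polynomial.degree_lt_iff_coeff_zero] at hp
    have : p = 0 := Polynomial.ext fun n => by simpa using hp n (Nat.zero_le n)
    simp [this, polyFun_zero, dbrNorm_zero]
  | succ n ih =>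
    obtain ⟨C, hC, h⟩ := ih
    refine ⟨2 * (D * C) + 2, by finiteness, fun p hp f => ?_⟩
    have hp' : p.divX ∈ Polynomial.degreeLT ℂ n := by
      rw [Polynomial.mem_degreeLT, Polynomial.degree_lt_iff_coeff_zero] at hp ⊢
      exact fun m hm => by simpa using hp (m + 1) (by omega)
    have hdec : polyFun p * f = polyFun Polynomial.X * (polyFun p.divX * f) +
        (fun _ => p.coeff 0) * f := by
      conv_lhs => rw [← Polynomial.divX_mul_X_add p, polyFun_add, polyFun_mul, polyFun_C]
      ring
    rw [hdec]
    refine (dbrNorm_sq_add_le _ _).trans ?_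
    have h1 : dbrNorm a (polyFun Polynomial.X * (polyFun p.divX * f)) ^ 2 ≤
        D * (C * hardyNorm (polyFun p) ^ 2 * dbrNorm a f ^ 2) := by
      refine (hDf _).trans ?_
      gcongr
      refine (h _ hp' f).trans ?_
      have := hardyNorm_divX_sq_le p
      gcongr
    have h2 : dbrNorm a ((fun _ => p.coeff 0) * f) ^ 2 ≤
        hardyNorm (polyFun p) ^ 2 * dbrNorm a f ^ 2 := by
      refine (dbrNorm_sq_const_mul_le _ _).trans ?_
      have := enorm_coeff_le_hardyNorm p 0
      gcongr
    calc _ ≤ 2 * (D * (C * hardyNorm (polyFun p) ^ 2 * dbrNorm a f ^ 2)) +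
          2 * (hardyNorm (polyFun p) ^ 2 * dbrNorm a f ^ 2) := by gcongr
      _ = _ := by ring

theorem ofReal_supNorm_le_hardyNorm (p : Polynomial ℂ) :
    ENNReal.ofReal p.supNorm ≤ hardyNorm (polyFun p) := by
  obtain ⟨i, hi⟩ := p.exists_eq_supNorm
  rw [hi, ofReal_norm]
  exact (ENNReal.pow_le_pow_left_iff two_ne_zero).1 (enorm_coeff_le_hardyNorm p i)

theorem exists_isPolyConstant (b a : RatFunc ℂ) : ∃ C₁ : ℝ≥0, IsPolyConstant b a C₁ := by
  obtain ⟨C, hC, h⟩ := exists_dbrNorm_sq_polyFun_mul_le a (boundaryDeg a)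
  lift C to ℝ≥0 using hC
  -- `C` bounds squares and `C ≤ (C + 1)²`; the added `1` also covers the coefficient bound and
  -- positivity.
  refine ⟨C + 1, by positivity, fun p hp => max_le ?_ (sInf_le fun f _ => ?_)⟩
  · refine (ofReal_supNorm_le_hardyNorm p).trans (le_mul_of_one_le_left zero_le ?_)
    push_cast
    exact le_add_left le_rfl
  · rw [← ENNReal.pow_le_pow_left_iff two_ne_zero, mul_pow, mul_pow]
    refine (h p hp f).trans ?_
    gcongr
    rw [sq]
    push_cast
    calc (C : ℝ≥0∞) ≤ (C + 1) * 1 := by rw [mul_one]; exact le_add_right le_rfl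
      _ ≤ _ := by gcongr; exact le_add_left le_rfl

end DbrNorm

/-! ### The reproducing kernel of the norm `‖·‖_b` and the test functions -/

section Diagonal

variable {a : RatFunc ℂ}

/-- The reproducing kernel of `a₁ H² + 𝒫_{N-1}` on the diagonal. -/
def diagKernel (a : RatFunc ℂ) (z : 𝔻) : ℝ :=
  ‖polyFun (boundaryPoly a) z‖ ^ 2 * (1 - ‖(z : ℂ)‖ ^ 2)⁻¹ +
    ∑ i ∈ Finset.range (boundaryDeg a), (‖(z : ℂ)‖ ^ 2) ^ i

theorem diagKernel_pos (a : RatFunc ℂ) (z : 𝔻) : 0 < diagKernel a z := by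
  have h0 : 0 < (1 - ‖(z : ℂ)‖ ^ 2)⁻¹ := inv_pos.2 (sub_pos.2 z.sq_norm_lt_one)
  rcases hN : boundaryDeg a with _ | k
  · have : boundaryPoly a = 1 := (boundaryPoly_monic a).natDegree_eq_zero.1 hN
    simpa [diagKernel, hN, this, polyFun] using z.sq_norm_lt_one
  · rw [diagKernel, hN, Finset.sum_range_succ']
    positivity

/-- One Cauchy–Schwarz inequality over both summands of a decomposition. The constant must be the
exact diagonal value for it to cancel in `constThree_le_columnNorm`. -/
theorem enorm_sq_apply_le (a : RatFunc ℂ) (f : 𝔻 → ℂ) (z : 𝔻) :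
    ‖f z‖ₑ ^ 2 ≤ ENNReal.ofReal (diagKernel a z) * dbrNorm a f ^ 2 := by
  refine le_mul_dbrNorm_sq (ENNReal.ofReal_pos.2 (diagKernel_pos a z)).ne' ENNReal.ofReal_ne_top
    fun g p h => ?_
  have hg := sq_norm_apply_le h.1 z
  have hp := sq_norm_polyFun_le h.2.1 z
  have h0 : 0 < (1 - ‖(z : ℂ)‖ ^ 2)⁻¹ := inv_pos.2 (sub_pos.2 z.sq_norm_lt_one)
  have e1 : hardyNorm g = ENNReal.ofReal (hardyNorm g).toReal :=
    (ENNReal.ofReal_toReal h.1.2.ne).symm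
  have e2 : hardyNorm (polyFun p) = ENNReal.ofReal (hardyNorm (polyFun p)).toReal :=
    (ENNReal.ofReal_toReal (polyFun_mem_hardySpace p).2.ne).symm
  rw [e1, e2, ← ofReal_norm, ← ENNReal.ofReal_pow (norm_nonneg _),
    ← ENNReal.ofReal_pow ENNReal.toReal_nonneg, ← ENNReal.ofReal_pow ENNReal.toReal_nonneg,
    ← ENNReal.ofReal_add (by positivity) (by positivity), ← ENNReal.ofReal_mul
    (diagKernel_pos a z).le]
  refine ENNReal.ofReal_le_ofReal ?_
  rw [h.2.2, diagKernel]
  simp only [Pi.add_apply, Pi.mul_apply]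
  set α := ‖polyFun (boundaryPoly a) z‖
  set S := (1 - ‖(z : ℂ)‖ ^ 2)⁻¹
  set T := ∑ i ∈ Finset.range (boundaryDeg a), (‖(z : ℂ)‖ ^ 2) ^ i
  have hT : 0 ≤ T := Finset.sum_nonneg fun _ _ => by positivity
  set G := (hardyNorm g).toReal
  set P := (hardyNorm (polyFun p)).toReal
  have hG : 0 ≤ G := ENNReal.toReal_nonneg
  have hP : 0 ≤ P := ENNReal.toReal_nonneg
  have hg' : ‖g z‖ ≤ G * √S := by
    refine le_of_sq_le_sq ?_ (by positivity)
    rwa [mul_pow, Real.sq_sqrt h0.le]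
  have hp' : ‖polyFun p z‖ ≤ P * √T := by
    refine le_of_sq_le_sq ?_ (by positivity)
    rwa [mul_pow, Real.sq_sqrt hT]
  have hsum : ‖polyFun (boundaryPoly a) z * g z + polyFun p z‖ ≤ α * √S * G + √T * P := by
    refine (norm_add_le _ _).trans ?_
    rw [norm_mul]
    have : α * ‖g z‖ ≤ α * (G * √S) := by gcongr
    linarith
  calc _ ≤ (α * √S * G + √T * P) ^ 2 := by gcongr
    _ ≤ ((α * √S) ^ 2 + √T ^ 2) * (G ^ 2 + P ^ 2) := by
      nlinarith [sq_nonneg (α * √S * P - √T * G)]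
    _ = _ := by rw [mul_pow, Real.sq_sqrt h0.le, Real.sq_sqrt hT]

/-- The value of the reproducing kernel of `a₁ H² + 𝒫_{N-1}` at `z` is attained. -/
theorem exists_dbrSpace_apply_eq_diagKernel {b : RatFunc ℂ} (hb : InUnitBall b)
    (ha : IsPythagoreanMate b a) (z : 𝔻) :
    ∃ k ∈ dbrSpace b, k z = diagKernel a z ∧
      dbrNorm a k ^ 2 ≤ ENNReal.ofReal (diagKernel a z) := by
  set β : ℂ := polyFun (boundaryPoly a) z with hβ
  set q : Polynomial ℂ := ∑ i ∈ Finset.range (boundaryDeg a),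
    Polynomial.monomial i (conj (z : ℂ) ^ i) with hq
  have h0 : 0 < (1 - ‖(z : ℂ)‖ ^ 2)⁻¹ := inv_pos.2 (sub_pos.2 z.sq_norm_lt_one)
  have hqc : ∀ i, q.coeff i = if i ∈ Finset.range (boundaryDeg a) then conj (z : ℂ) ^ i else 0 :=
    fun i => by simp [hq, Polynomial.coeff_monomial]
  have hqm : q ∈ Polynomial.degreeLT ℂ (boundaryDeg a) := by
    rw [Polynomial.mem_degreeLT, Polynomial.degree_lt_iff_coeff_zero]
    exact fun m hm => by rw [hqc, if_neg (by simpa using hm)]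
  have hqn : hardyNorm (polyFun q) ^ 2 =
      ENNReal.ofReal (∑ i ∈ Finset.range (boundaryDeg a), (‖(z : ℂ)‖ ^ 2) ^ i) := by
    rw [hardyNorm_polyFun_sq, tsum_eq_sum (s := Finset.range (boundaryDeg a)) fun n hn => by
      rw [hqc, if_neg hn]; simp, ENNReal.ofReal_sum_of_nonneg fun _ _ => by positivity]
    refine Finset.sum_congr rfl fun i hi => ?_
    rw [hqc, if_pos hi, ← ofReal_norm, ← ENNReal.ofReal_pow (norm_nonneg _), norm_pow,
      RCLike.norm_conj, ← pow_mul, ← pow_mul, mul_comm]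
  -- The witness is the kernel function at `z`: `a₁ conj(a₁(z)) s_z` for the Hardy part, plus the
  -- truncated Szegő kernel `q` for the polynomials.
  have hdec : IsDecomposition a
      (polyFun (boundaryPoly a) * ((fun _ => conj β) * fun w : 𝔻 => szego z w) + polyFun q)
      ((fun _ => conj β) * fun w : 𝔻 => szego z w) q :=
    ⟨mul_mem_hardySpace (isHolomorphic_const _) (ENNReal.pow_ne_top enorm_ne_top)
      (fun _ => le_rfl) (szego_mem_hardySpace z), hqm, rfl⟩
  refine ⟨_, AverageBounded.mem_dbrSpace hb ha ?_, ?_, hdec.dbrNorm_sq_le.trans ?_⟩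
  · refine AverageBounded.add ?_ (averageBounded_polyFun ha q)
    convert! (averageBounded_polyFun_mul_szego ha z (boundaryPoly a)).const_mul (conj β) using 1
    funext w
    simp only [Pi.mul_apply]
    ring
  · have hqz : polyFun q z = ∑ i ∈ Finset.range (boundaryDeg a), ((‖(z : ℂ)‖ : ℂ) ^ 2) ^ i := by
      simp only [polyFun, hq, Polynomial.eval_finsetSum, Polynomial.eval_monomial, ← mul_pow,
        Complex.conj_mul']
    simp only [Pi.add_apply, Pi.mul_apply, diagKernel, hqz, ← hβ, szego, Complex.conj_mul']
    rw [← mul_assoc, Complex.mul_conj']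
    push_cast
    rfl
  · rw [hqn, diagKernel, ENNReal.ofReal_add (by positivity)
      (Finset.sum_nonneg fun _ _ => by positivity)]
    gcongr
    refine (hardyNorm_sq_const_mul_le _ _).trans_eq ?_
    rw [hardyNorm_szego_sq, ENNReal.ofReal_mul (by positivity), ← ofReal_norm, RCLike.norm_conj,
      ENNReal.ofReal_pow (norm_nonneg _)]

theorem exists_one_mem_dbrSpace {b : RatFunc ℂ} (hb : InUnitBall b)
    (ha : IsPythagoreanMate b a) : 1 ∈ dbrSpace b ∧ dbrNorm a 1 ≤ 1 := by
  have h1 : polyFun 1 = 1 := by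
    funext z
    simp [polyFun]
  have hn : hardyNorm (1 : 𝔻 → ℂ) ^ 2 = 1 := by
    rw [← h1, hardyNorm_polyFun_sq, tsum_eq_single 0 fun n hn => by
      simp [Polynomial.coeff_one, hn]]
    simp
  refine ⟨h1 ▸ (averageBounded_polyFun ha 1).mem_dbrSpace hb ha, ?_⟩
  rw [← ENNReal.pow_le_pow_left_iff two_ne_zero, one_pow]
  -- The constant `1` is the Hardy part when `N = 0`, where `a₁ = 1`, and the polynomial part
  -- otherwise.
  rcases hN : boundaryDeg a with _ | k
  · have hb1 : boundaryPoly a = 1 := (boundaryPoly_monic a).natDegree_eq_zero.1 hN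
    have h := (isDecomposition_mul_boundaryPoly (a := a) (polyFun_mem_hardySpace 1)).dbrNorm_sq_le
    rwa [hb1, h1, mul_one, polyFun_zero, hn, hardyNorm_zero_sq, add_zero] at h
  · have hm : (1 : Polynomial ℂ) ∈ Polynomial.degreeLT ℂ (boundaryDeg a) := by
      rw [Polynomial.mem_degreeLT, hN, Polynomial.degree_one]
      exact_mod_cast Nat.succ_pos k
    have h := (isDecomposition_polyFun hm).dbrNorm_sq_le
    rwa [h1, hn, hardyNorm_zero_sq, zero_add] at h

end Diagonal

/-! ### Bounds for the column multiplier -/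

section Column

variable {b a : RatFunc ℂ}

theorem directSumNorm_sq (a : RatFunc ℂ) (F : ℕ → 𝔻 → ℂ) :
    directSumNorm a F ^ 2 = ∑' j, dbrNorm a (F j) ^ 2 := rpow_half_sq _

theorem constTwo_sq (a : RatFunc ℂ) (Φ : ℕ → 𝔻 → ℂ) :
    constTwo a Φ ^ 2 = ∑' j, dbrNorm a (Φ j) ^ 2 := rpow_half_sq _

theorem tsum_enorm_sq_le_constThree_sq (Φ : ℕ → 𝔻 → ℂ) (z : 𝔻) :
    ∑' j, ‖Φ j z‖ₑ ^ 2 ≤ constThree Φ ^ 2 := by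
  rw [← rpow_half_sq (∑' j, ‖Φ j z‖ₑ ^ 2), ENNReal.pow_le_pow_left_iff two_ne_zero]
  exact le_iSup (fun z => (∑' j, ‖Φ j z‖ₑ ^ 2) ^ (1 / 2 : ℝ)) z

theorem constTwo_le_columnNorm (hb : InUnitBall b) (ha : IsPythagoreanMate b a)
    (Φ : ℕ → 𝔻 → ℂ) : constTwo a Φ ≤ columnNorm b a Φ := by
  obtain ⟨h1, h2⟩ := exists_one_mem_dbrSpace hb ha
  refine le_sInf fun C hC => ?_
  have h := hC 1 h1
  have he : columnMul Φ 1 = Φ := funext fun j => mul_one (Φ j)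
  rw [he] at h
  exact h.trans (mul_le_of_le_one_right zero_le h2)

theorem constThree_le_columnNorm (hb : InUnitBall b) (ha : IsPythagoreanMate b a)
    (Φ : ℕ → 𝔻 → ℂ) : constThree Φ ≤ columnNorm b a Φ := by
  refine le_sInf fun C hC => iSup_le fun z => ?_
  rw [← ENNReal.pow_le_pow_left_iff two_ne_zero, rpow_half_sq]
  obtain ⟨k, hk, hkz, hkn⟩ := exists_dbrSpace_apply_eq_diagKernel hb ha z
  set κ := ENNReal.ofReal (diagKernel a z) with hκ
  have hκ0 : κ ≠ 0 := (ENNReal.ofReal_pos.2 (diagKernel_pos a z)).ne'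
  have hκt : κ ≠ ∞ := ENNReal.ofReal_ne_top
  have hkz' : ‖k z‖ₑ = κ := by
    rw [hkz, ← ofReal_norm, Complex.norm_real, Real.norm_of_nonneg (diagKernel_pos a z).le]
  have h := (ENNReal.pow_le_pow_left_iff two_ne_zero).2 (hC k hk)
  rw [directSumNorm_sq, mul_pow] at h
  have hmain : (∑' j, ‖Φ j z‖ₑ ^ 2) * κ ^ 2 ≤ C ^ 2 * κ ^ 2 :=
    calc (∑' j, ‖Φ j z‖ₑ ^ 2) * κ ^ 2 = ∑' j, ‖columnMul Φ k j z‖ₑ ^ 2 := by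
          rw [← ENNReal.tsum_mul_right]
          refine tsum_congr fun j => ?_
          rw [columnMul, Pi.mul_apply, enorm_mul, mul_pow, hkz']
      _ ≤ ∑' j, κ * dbrNorm a (columnMul Φ k j) ^ 2 :=
          ENNReal.tsum_le_tsum fun j => enorm_sq_apply_le a _ z
      _ ≤ κ * (C ^ 2 * κ) := by
          rw [ENNReal.tsum_mul_left]
          gcongr
          exact h.trans (by gcongr)
      _ = C ^ 2 * κ ^ 2 := by ring
  exact (ENNReal.mul_le_mul_iff_left (pow_ne_zero 2 hκ0) (ENNReal.pow_ne_top hκt)).1 hmain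

/-- Every `t > C` exceeds some admissible constant; letting `t` decrease to `C` gives the bound. -/
theorem dbrNorm_mul_le_multiplierNorm {φ f : 𝔻 → ℂ} (hf : f ∈ dbrSpace b) {C : ℝ≥0∞}
    (hC : multiplierNorm b a φ ≤ C) (hCt : C ≠ ∞) (hft : dbrNorm a f ≠ ∞) :
    dbrNorm a (φ * f) ≤ C * dbrNorm a f := by
  have h : ∀ t > C, dbrNorm a (φ * f) ≤ t * dbrNorm a f := fun t ht => by
    obtain ⟨s, hs, hst⟩ := sInf_lt_iff.1 (hC.trans_lt ht)
    exact (hs f hf).trans (by gcongr)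
  by_cases h0 : dbrNorm a f = 0
  · have := h (C + 1) (ENNReal.lt_add_right hCt one_ne_zero)
    rwa [h0, mul_zero] at this ⊢
  · rw [← ENNReal.div_le_iff h0 hft]
    refine le_of_forall_gt_imp_ge_of_dense fun t ht => ?_
    rw [ENNReal.div_le_iff h0 hft]
    exact h t ht

theorem directSumNorm_columnMul_le {Φ : ℕ → 𝔻 → ℂ} (hΦ : ∀ j, Φ j ∈ dbrSpace b) {C₁ : ℝ≥0}
    (hC₁ : IsPolyConstant b a C₁) (h2 : constTwo a Φ < ∞) (h3 : constThree Φ < ∞) (f : 𝔻 → ℂ) :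
    directSumNorm a (columnMul Φ f) ≤
      ENNReal.ofReal √2 * max (constThree Φ) (C₁ * constTwo a Φ) * dbrNorm a f := by
  set M := max (constThree Φ) (C₁ * constTwo a Φ) with hM
  have hMt : M ≠ ∞ := (max_lt h3 (ENNReal.mul_lt_top ENNReal.coe_lt_top h2)).ne
  have hs2 : ENNReal.ofReal √2 ^ 2 = 2 := by
    rw [← ENNReal.ofReal_pow (by positivity), Real.sq_sqrt (by positivity), ENNReal.ofReal_ofNat]
  rw [← ENNReal.pow_le_pow_left_iff two_ne_zero, directSumNorm_sq, mul_pow, mul_pow, hs2]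
  -- Separated because `le_mul_dbrNorm_sq` needs a nonzero constant; here `C₃ = 0` forces every `Φ
  -- j` to vanish.
  by_cases hM0 : M = 0
  · have hz : ∀ j, Φ j = 0 := fun j => funext fun z => by
      have h3z : constThree Φ = 0 := le_zero_iff.1 (hM0 ▸ le_max_left _ _)
      have h := (ENNReal.le_tsum j).trans (tsum_enorm_sq_le_constThree_sq Φ z)
      simpa [h3z] using h
    simp [columnMul, hz, dbrNorm_zero]
  have hft : ∀ j, dbrNorm a (Φ j) < ∞ := fun j => by
    refine lt_top_of_sq_lt_top ((ENNReal.le_tsum (f := fun j => dbrNorm a (Φ j) ^ 2) j).trans_lt ?_)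
    rw [← constTwo_sq]
    exact ENNReal.pow_lt_top h2
  -- Finiteness of `C₂` gives each `Φ j` a finite norm, hence a decomposition, hence holomorphy.
  have hhol : ∀ j, IsHolomorphic (Φ j) := fun j =>
    let ⟨_, _, h⟩ := exists_isDecomposition (hft j)
    h.isHolomorphic
  have h3t : constThree Φ ^ 2 ≠ ∞ := ENNReal.pow_ne_top h3.ne
  refine le_mul_dbrNorm_sq (by simpa using hM0) (by finiteness) fun g p hd => ?_
  have hterm : ∀ j, dbrNorm a (columnMul Φ f j) ^ 2 ≤ 2 * hardyNorm (Φ j * g) ^ 2 +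
      2 * ((C₁ * hardyNorm (polyFun p)) ^ 2 * dbrNorm a (Φ j) ^ 2) := fun j => by
    have he : columnMul Φ f j = polyFun (boundaryPoly a) * (Φ j * g) + polyFun p * Φ j := by
      rw [columnMul, hd.2.2]
      ring
    have hmem : Φ j * g ∈ hardySpace := mul_mem_hardySpace (hhol j) h3t
      (fun z => (ENNReal.le_tsum j).trans (tsum_enorm_sq_le_constThree_sq Φ z)) hd.1
    rw [he]
    refine (dbrNorm_sq_add_le _ _).trans ?_
    have e1 := (isDecomposition_mul_boundaryPoly (a := a) hmem).dbrNorm_sq_le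
    rw [polyFun_zero, hardyNorm_zero_sq, add_zero] at e1
    have e2 := dbrNorm_mul_le_multiplierNorm (a := a) (hΦ j)
      ((le_max_right _ _).trans (hC₁.2 p hd.2.1))
      (ENNReal.mul_ne_top ENNReal.coe_ne_top (polyFun_mem_hardySpace p).2.ne) (hft j).ne
    have e3 := (ENNReal.pow_le_pow_left_iff two_ne_zero).2 e2
    rw [mul_pow] at e3
    gcongr
  refine (ENNReal.tsum_le_tsum hterm).trans ?_
  rw [ENNReal.tsum_add, ENNReal.tsum_mul_left, ENNReal.tsum_mul_left, ENNReal.tsum_mul_left,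
    ← constTwo_sq, mul_add]
  refine add_le_add ?_ ?_
  · rw [mul_assoc]
    gcongr
    refine (tsum_hardyNorm_sq_mul_le hhol hd.1.1 h3t (tsum_enorm_sq_le_constThree_sq Φ)).trans ?_
    gcongr
    exact le_max_left _ _
  · rw [mul_assoc]
    refine mul_le_mul_right ?_ 2
    calc _ = (C₁ * constTwo a Φ) ^ 2 * hardyNorm (polyFun p) ^ 2 := by ring
      _ ≤ _ := by
        gcongr
        exact le_max_right _ _

theorem columnNorm_le {Φ : ℕ → 𝔻 → ℂ} (hΦ : ∀ j, Φ j ∈ dbrSpace b) {C₁ : ℝ≥0}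
    (hC₁ : IsPolyConstant b a C₁) :
    columnNorm b a Φ ≤ ENNReal.ofReal √2 * max (constThree Φ) (C₁ * constTwo a Φ) := by
  have hs : ENNReal.ofReal √2 ≠ 0 := (ENNReal.ofReal_pos.2 (by positivity)).ne'
  rcases eq_or_ne (constThree Φ) ∞ with h3 | h3
  · rw [h3, max_eq_left le_top, ENNReal.mul_top hs]
    exact le_top
  rcases eq_or_ne (constTwo a Φ) ∞ with h2 | h2
  -- Positivity of `C₁` excludes the convention `0 * ∞ = 0`.
  · rw [h2, ENNReal.mul_top (by exact_mod_cast hC₁.1.ne'), max_eq_right le_top,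
      ENNReal.mul_top hs]
    exact le_top
  exact sInf_le fun f _ => directSumNorm_columnMul_le hΦ hC₁ h2.lt_top h3.lt_top f

theorem isBoundedColumn_iff (hb : InUnitBall b) (ha : IsPythagoreanMate b a) {Φ : ℕ → 𝔻 → ℂ}
    (hΦ : ∀ j, Φ j ∈ multipliers b) :
    IsBoundedColumn b a Φ ↔ constTwo a Φ < ∞ ∧ constThree Φ < ∞ := by
  constructor
  · rintro ⟨C, hC⟩
    have h : columnNorm b a Φ < ∞ :=
      lt_of_le_of_lt (sInf_le fun f hf => (hC f hf).2) (ENNReal.coe_lt_top (r := C))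
    exact ⟨(constTwo_le_columnNorm hb ha Φ).trans_lt h,
      (constThree_le_columnNorm hb ha Φ).trans_lt h⟩
  · rintro ⟨h2, h3⟩
    obtain ⟨C₁, hC₁⟩ := exists_isPolyConstant b a
    have hfin : ENNReal.ofReal √2 * max (constThree Φ) (C₁ * constTwo a Φ) ≠ ∞ :=
      ENNReal.mul_ne_top ENNReal.ofReal_ne_top
        (max_lt h3 (ENNReal.mul_lt_top ENNReal.coe_lt_top h2)).ne
    refine ⟨(ENNReal.ofReal √2 * max (constThree Φ) (C₁ * constTwo a Φ)).toNNReal,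
      fun f hf => ⟨fun j => (hΦ j).2 f hf, ?_⟩⟩
    rw [ENNReal.coe_toNNReal hfin]
    exact directSumNorm_columnMul_le (fun j => (hΦ j).1) hC₁ h2 h3 f

end Column

end DBR

end

theorem mainTheorem5 (b a : RatFunc ℂ) (hb : DBR.InUnitBall b) (hB : ¬ DBR.IsFiniteBlaschke b)
    (ha : DBR.IsPythagoreanMate b a) :
    (∃ C₁ : ℝ≥0, DBR.IsPolyConstant b a C₁) ∧
    ∀ Φ : ℕ → 𝔻 → ℂ, (∀ j, Φ j ∈ DBR.multipliers b) →
      (DBR.IsBoundedColumn b a Φ ↔ DBR.constTwo a Φ < ∞ ∧ DBR.constThree Φ < ∞) ∧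
      max (DBR.constTwo a Φ) (DBR.constThree Φ) ≤ DBR.columnNorm b a Φ ∧
      ∀ C₁ : ℝ≥0, DBR.IsPolyConstant b a C₁ →
        DBR.columnNorm b a Φ ≤
          ENNReal.ofReal (Real.sqrt 2) *
            max (DBR.constThree Φ) (C₁ * DBR.constTwo a Φ) :=
  ⟨DBR.exists_isPolyConstant b a, fun Φ hΦ => ⟨DBR.isBoundedColumn_iff hb ha hΦ,
    max_le (DBR.constTwo_le_columnNorm hb ha Φ) (DBR.constThree_le_columnNorm hb ha Φ),
    fun _ hC₁ => DBR.columnNorm_le (fun j => (hΦ j).1) hC₁⟩⟩
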